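/- Explicit star product to third order. Let $A$ be an algebra of smooth complex-valued functions on $\mathbb{R}^N$ (under pointwise operations) that contains the coordinates $x^i$ and is closed under complex conjugation and partial derivatives (for instance all smooth functions, or all polynomials), and let $P^{ij}=-P^{ji}\in A$ be a real bivector field; no Jacobi identity is assumed. Repeated indices are summed. Let $$f\star g=fg+\sum_{r\ge 1}(\mathrm i\alpha)^rC_r(f,g),\qquad f,g\in A,$$ extended $\mathbb{C}[[\alpha]]$-bilinearly to $A[[\alpha]]$, where the $C_r$ are bidifferential operators with coefficients in $A$, be a (not necessarily associative) star product with $C_1(f,g)-C_1(g,f)=2P^{ij}\partial_if\,\partial_jg$ and $f\star1=1\star f=f$. Assume that it is: - *Weyl*: $(x^{i_1}\cdots x^{i_n})\star f=\frac1{n!}\sum_{\sigma\in S_n}x^{i_{\sigma(1)}}\star(\cdots\star(x^{i_{\sigma(n)}}\star f)\cdots)$ for all $n$, all $i_1,\dots,i_n$ and all $f\in A$; - *weakly Hermitian*: $(x^j\star f)^*=f^*\star x^j$ for all $j$ and all $f\in A$ ($\alpha$ is a real formal parameter); - *strictly triangular*: at most $r$ derivatives act on each of $f$ and $g$ in $C_r(f,g)$,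 and, writing $$x^i\star g=x^ig+\sum_{n\ge1}\sum_{k\ge0}(\mathrm i\alpha)^{k+n}\,\Gamma_k^{ij_1\dots j_n}\,\partial_{j_1}\cdots\partial_{j_n}g$$ with $\Gamma_k^{ij_1\dots j_n}\in A$ symmetric in $j_1,\dots,j_n$, one has $\Gamma_k^{ij}=0$ for $k\ge1$. Then $\Gamma_0^{ij}=P^{ij}$ and $$\Gamma_0^{ijk}=\tfrac16\left(P^{kl}\partial_lP^{ji}+P^{jl}\partial_lP^{ki}\right),$$ $$\Gamma_0^{ijkl}=\tfrac1{18}\left(P^{jm}P^{kn}\partial_m\partial_nP^{il}+P^{lm}P^{kn}\partial_m\partial_nP^{ij}+P^{jm}P^{ln}\partial_m\partial_nP^{ik}\right),$$ $$\Gamma_1^{ijk}=\tfrac16\left(P^{lm}\partial_lP^{kn}\,\partial_m\partial_nP^{ij}+P^{lm}\partial_lP^{jn}\,\partial_m\partial_nP^{ik}\right),$$ and, for all $f,g\in A$, modulo $\alpha^4$, $$f\star g=fg+\mathrm i\alpha\,\partial_if\,P^{ij}\,\partial_jg-\tfrac{\alpha^2}{2}P^{ij}P^{kl}\,\partial_i\partial_kf\,\partial_j\partial_lg-\tfrac{\alpha^2}{3}P^{ij}\partial_jP^{kl}\left(\partial_i\partial_kf\,\partial_lg-\partial_kf\,\partial_i\partial_lg\right)+f\star_3g,$$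 where $$\begin{aligned}f\star_3g=-\mathrm i\alpha^3\Big[&\tfrac13P^{nl}\partial_lP^{mk}\,\partial_n\partial_mP^{ij}\left(\partial_if\,\partial_j\partial_kg-\partial_ig\,\partial_j\partial_kf\right)\\&+\tfrac16P^{nk}\partial_nP^{jm}\,\partial_mP^{il}\left(\partial_i\partial_jf\,\partial_k\partial_lg-\partial_i\partial_jg\,\partial_k\partial_lf\right)\\&+\tfrac13P^{ln}\partial_lP^{jm}\,P^{ik}\left(\partial_i\partial_jf\,\partial_k\partial_n\partial_mg-\partial_i\partial_jg\,\partial_k\partial_n\partial_mf\right)\\&+\tfrac16P^{jl}P^{im}P^{kn}\,\partial_i\partial_j\partial_kf\,\partial_l\partial_n\partial_mg\\&+\tfrac16P^{nk}P^{ml}\,\partial_n\partial_mP^{ij}\left(\partial_if\,\partial_j\partial_k\partial_lg-\partial_ig\,\partial_j\partial_k\partial_lf\right)\Big].\end{aligned}$$ -/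

import Mathlib

open scoped ContDiff PowerSeries

noncomputable section

/-- An algebra `A` of smooth complex-valued functions on `ℝ^N`: it is closed under the pointwise
operations, complex conjugation and partial derivatives, and it contains the coordinates.
All smooth functions, or all polynomials, are examples. -/
structure FunctionAlgebra (N : ℕ) where
  carrier : StarSubalgebra ℂ ((Fin N → ℝ) → ℂ)
  smooth_mem : ∀ f ∈ carrier, ContDiff ℝ ∞ f
  pderiv_mem : ∀ f ∈ carrier, ∀ i : Fin N,
    (fun x => fderiv ℝ f x (Pi.single i (1 : ℝ))) ∈ carrier
  coord_mem : ∀ i : Fin N, (fun x : Fin N → ℝ => ((x i : ℝ) : ℂ)) ∈ carrier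

namespace FunctionAlgebra

variable {N : ℕ} (A : FunctionAlgebra N)

/-- The elements of the algebra `A`, with the pointwise (commutative) product. -/
abbrev Fn : Type := A.carrier

/-- The partial derivative `∂_i f`. -/
def pd (i : Fin N) (f : A.Fn) : A.Fn :=
  ⟨fun x => fderiv ℝ (f : (Fin N → ℝ) → ℂ) x (Pi.single i (1 : ℝ)), A.pderiv_mem f f.2 i⟩

/-- The iterated partial derivative `∂_{j_1} ⋯ ∂_{j_n} f`. -/
def pdMulti {n : ℕ} (J : Fin n → Fin N) (f : A.Fn) : A.Fn :=
  (List.ofFn J).foldr A.pd f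

/-- The coordinate function `x^i`. -/
def coord (i : Fin N) : A.Fn :=
  ⟨fun x => ((x i : ℝ) : ℂ), A.coord_mem i⟩

/-- `B` is a bidifferential operator with coefficients in `A`, of order at most `m` in each of its
two arguments. -/
def IsBidiff (m : ℕ) (B : A.Fn → A.Fn → A.Fn) : Prop :=
  ∃ c : (a b : ℕ) → (Fin a → Fin N) → (Fin b → Fin N) → A.Fn,
    ∀ f g : A.Fn, B f g =
      ∑ a ∈ Finset.range (m + 1), ∑ b ∈ Finset.range (m + 1),
        ∑ I : Fin a → Fin N, ∑ J : Fin b → Fin N,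
          c a b I J * A.pdMulti I f * A.pdMulti J g

/-- A (real) bivector field `P^{ij}` with components in `A`. -/
structure IsBivector (P : Fin N → Fin N → A.Fn) : Prop where
  real : ∀ i j, star (P i j) = P i j
  antisymm : ∀ i j, P i j = - P j i

/-- The quasi-Poisson bracket `{f, g}_Q = P^{ij} ∂_i f ∂_j g`. No Jacobi identity is imposed. -/
def bracket (P : Fin N → Fin N → A.Fn) (f g : A.Fn) : A.Fn :=
  ∑ i, ∑ j, P i j * A.pd i f * A.pd j g

/-- The product on `A⟦α⟧` given by `f ⋆ g = ∑ r, (iα)^r C_r(f, g)` for `f, g` in `A`, extended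
`ℂ⟦α⟧`-bilinearly: the coefficient of `α^n` in `F ⋆ G` is
`∑_{r + s + t = n} i^r C_r(F_s, G_t)`. -/
def starMul (C : ℕ → A.Fn → A.Fn → A.Fn) (F G : A.Fn⟦X⟧) : A.Fn⟦X⟧ :=
  PowerSeries.mk fun n =>
    ∑ p ∈ Finset.HasAntidiagonal.antidiagonal n, ∑ q ∈ Finset.HasAntidiagonal.antidiagonal p.2,
      (Complex.I ^ p.1) • C p.1 (PowerSeries.coeff q.1 F) (PowerSeries.coeff q.2 G)

/-- A (not necessarily associative) star product on `A⟦α⟧` that quantizes the bracket of `P` and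
does not change the unity. -/
structure StarProduct (P : Fin N → Fin N → A.Fn) where
  C : ℕ → A.Fn → A.Fn → A.Fn
  C_zero : ∀ f g, C 0 f g = f * g
  bidiff : ∀ r, ∃ m, A.IsBidiff m (C r)
  quantizes : ∀ f g, C 1 f g - C 1 g f = (2 : ℂ) • A.bracket P f g
  star_one : ∀ f : A.Fn, A.starMul C (PowerSeries.C f) 1 = PowerSeries.C f
  one_star : ∀ f : A.Fn, A.starMul C 1 (PowerSeries.C f) = PowerSeries.C f

end FunctionAlgebra

namespace FunctionAlgebra.StarProduct

variable {N : ℕ} {A : FunctionAlgebra N} {P : Fin N → Fin N → A.Fn} (S : A.StarProduct P)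

/-- The product `F ⋆ G` of two elements of `A⟦α⟧`. -/
def mul (F G : A.Fn⟦X⟧) : A.Fn⟦X⟧ := A.starMul S.C F G

/-- `x^{i_1} ⋆ (x^{i_2} ⋆ (⋯ ⋆ (x^{i_n} ⋆ F)))`. -/
def nested (l : List (Fin N)) (F : A.Fn⟦X⟧) : A.Fn⟦X⟧ :=
  l.foldr (fun i G => S.mul (PowerSeries.C (A.coord i)) G) F

/-- The Weyl condition: `(x^{i_1} ⋯ x^{i_n}) ⋆ f` is the average over all permutations of
`x^{i_1} ⋆ (⋯ ⋆ (x^{i_n} ⋆ f))`. -/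
def IsWeyl : Prop :=
  ∀ (n : ℕ) (J : Fin n → Fin N) (f : A.Fn),
    S.mul (PowerSeries.C (∏ a, A.coord (J a))) (PowerSeries.C f) =
      (1 / (n.factorial : ℂ)) • ∑ σ : Equiv.Perm (Fin n),
        S.nested (List.ofFn fun a => J (σ a)) (PowerSeries.C f)

/-- Weak Hermiticity: `(x^j ⋆ f)^* = f^* ⋆ x^j`, where the conjugation of `A⟦α⟧` acts on the
coefficients (the formal parameter `α` is real). -/
def IsWeaklyHermitian : Prop :=
  ∀ (j : Fin N) (f : A.Fn),
    PowerSeries.map (starRingEnd A.Fn)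
        (S.mul (PowerSeries.C (A.coord j)) (PowerSeries.C f)) =
      S.mul (PowerSeries.C (star f)) (PowerSeries.C (A.coord j))

/-- Triangularity: at most `r` derivatives act on `f`, and at most `r` on `g`, in `C_r(f, g)`. -/
def IsTriangular : Prop := ∀ r, A.IsBidiff r (S.C r)

/-- `Γ k n i (j_1, …, j_n)` are the coefficients `Γ_k^{i j_1 … j_n}` of the expansion
`x^i ⋆ g = x^i g + ∑_{n ≥ 1} ∑_{k ≥ 0} (iα)^k Γ_k^{i j_1 … j_n} (iα)^n ∂_{j_1} ⋯ ∂_{j_n} g`,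
symmetric in the last `n` indices. (The values for `n = 0` play no role.) -/
structure HasCoeffs (Γ : ℕ → (n : ℕ) → Fin N → (Fin n → Fin N) → A.Fn) : Prop where
  symm : ∀ (k n : ℕ) (i : Fin N) (J : Fin n → Fin N) (σ : Equiv.Perm (Fin n)),
    Γ k n i (fun a => J (σ a)) = Γ k n i J
  expansion : ∀ (i : Fin N) (g : A.Fn) (r : ℕ), 1 ≤ r →
    PowerSeries.coeff r (S.mul (PowerSeries.C (A.coord i)) (PowerSeries.C g)) =
      (Complex.I ^ r) • ∑ n ∈ Finset.Icc 1 r, ∑ J : Fin n → Fin N,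
        Γ (r - n) n i J * A.pdMulti J g

/-- Strict triangularity: `Γ^{ij}(α, x)` has no `α`-corrections, that is, `Γ_k^{ij} = 0` for
`k ≥ 1`. -/
def IsStrictlyTriangular : Prop :=
  S.IsTriangular ∧ ∃ Γ, S.HasCoeffs Γ ∧ ∀ k, 1 ≤ k → ∀ i j, Γ k 1 i ![j] = 0

end FunctionAlgebra.StarProduct

end

/-! Write C_r for `S.bil r`. A bidifferential operator of order at most three in each argument is
determined by its values at each point x on pairs (l^a, m^b), where a, b ≤ 3 and l, m are real
affine functions vanishing at x. Taylor polynomials reduce each argument to a polynomial in centred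
coordinates, and polarization reduces monomials to powers (`JetForm.eq_zero`,
`eq_of_forall_evalAt_pow`). The theorem thus becomes a finite computation of the numbers C_r(l^a,
m^b)(x) for r ≤ 3.

The Weyl condition says that left multiplication by l^n, applied to elements of A, is the n-th power
of left multiplication by l (`IsWeyl.leftMul_pow`). Order by order this gives a recursion that
brings C_r(l^(n+1), g) down to the operators C_s(l, ·) (`IsWeyl.bil_pow_succ`). Applied to g = 1 it
gives l ⋆ l^n = l^(n+1), hence C_r(l, l^n) = 0 for r > 0. Polarizing this last identity expresses
C_r(l, l m) by C_r(m, l^2), and C_r(l, l^2 m) by C_r(m, l^3).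

Strict triangularity makes C_2 and C_3 vanish on pairs of affine functions. Weak Hermiticity
identifies C_r(l^n, m) with (-1)^r times the conjugate of X = C_r(m, l^n). The recursion for
C_r(l^n, m) therefore becomes a linear equation relating X, its conjugate and known real data;
together with the conjugate equation it determines X. This is the heart of the argument:
`bil_two_sq`, `bil_three_sq` and `bil_three_cube`. It fixes C_2(l, ·) and C_3(l, ·), hence the
coefficients Γ; the recursion then yields all remaining values on powers, which are matched with the
explicit index sums. -/

noncomputable section

namespace FunctionAlgebra

variable {N : ℕ} (A : FunctionAlgebra N)

/-! ### Partial derivatives as commuting derivations of `A`, compatible with conjugation. -/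

section Calculus

variable {A}

theorem contDiff_coe (f : A.Fn) : ContDiff ℝ ∞ (f : (Fin N → ℝ) → ℂ) := A.smooth_mem f f.2

theorem differentiableAt_coe (f : A.Fn) (x : Fin N → ℝ) :
    DifferentiableAt ℝ (f : (Fin N → ℝ) → ℂ) x :=
  ((contDiff_coe f).differentiable (by simp)) x

theorem pd_add (i : Fin N) (f g : A.Fn) : A.pd i (f + g) = A.pd i f + A.pd i g := by
  ext x
  change fderiv ℝ ((f : (Fin N → ℝ) → ℂ) + (g : (Fin N → ℝ) → ℂ)) x _ = _
  rw [fderiv_add (differentiableAt_coe f x) (differentiableAt_coe g x)]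
  rfl

theorem pd_mul (i : Fin N) (f g : A.Fn) :
    A.pd i (f * g) = f * A.pd i g + g * A.pd i f := by
  ext x
  change fderiv ℝ ((f : (Fin N → ℝ) → ℂ) * (g : (Fin N → ℝ) → ℂ)) x _ = _
  rw [fderiv_mul (differentiableAt_coe f x) (differentiableAt_coe g x)]
  rfl

theorem pd_smul (i : Fin N) (c : ℂ) (f : A.Fn) : A.pd i (c • f) = c • A.pd i f := by
  ext x
  change fderiv ℝ (c • (f : (Fin N → ℝ) → ℂ)) x _ = _
  rw [fderiv_const_smul (differentiableAt_coe f x)]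
  rfl

/-- The partial derivative as a derivation of `A`. -/
def pdDerivation (i : Fin N) : Derivation ℂ A.Fn A.Fn :=
  Derivation.mk' ⟨⟨A.pd i, pd_add i⟩, pd_smul i⟩ (fun f g => by
    simpa using pd_mul i f g)

theorem pd_neg (i : Fin N) (f : A.Fn) : A.pd i (-f) = -A.pd i f := map_neg (pdDerivation i) f

theorem pd_sub (i : Fin N) (f g : A.Fn) : A.pd i (f - g) = A.pd i f - A.pd i g :=
  map_sub (pdDerivation i) f g

theorem pd_zero (i : Fin N) : A.pd i (0 : A.Fn) = 0 := map_zero (pdDerivation i)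

theorem pd_one (i : Fin N) : A.pd i (1 : A.Fn) = 0 := (pdDerivation i).map_one_eq_zero

theorem pd_sum {ι : Type*} (i : Fin N) (s : Finset ι) (f : ι → A.Fn) :
    A.pd i (∑ a ∈ s, f a) = ∑ a ∈ s, A.pd i (f a) := map_sum (pdDerivation i) f s

theorem pd_star (i : Fin N) (f : A.Fn) : A.pd i (star f) = star (A.pd i f) := by
  ext x
  change fderiv ℝ (fun y => star ((f : (Fin N → ℝ) → ℂ) y)) x _ = star (fderiv ℝ _ x _)
  rw [fderiv_star]
  rfl

theorem pd_coord (i j : Fin N) : A.pd i (A.coord j) = if i = j then 1 else 0 := by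
  ext x
  have h : HasFDerivAt (fun y : Fin N → ℝ => ((y j : ℝ) : ℂ))
      (Complex.ofRealCLM.comp (ContinuousLinearMap.proj (R := ℝ) (φ := fun _ : Fin N => ℝ) j)) x :=
    (Complex.ofRealCLM.comp (ContinuousLinearMap.proj (R := ℝ) (φ := fun _ : Fin N => ℝ) j)).hasFDerivAt
  change fderiv ℝ (fun y : Fin N → ℝ => ((y j : ℝ) : ℂ)) x _ = _
  rw [h.fderiv]
  by_cases hij : i = j
  · subst hij; simp
  · simp [hij, Ne.symm hij]

theorem pd_comm (i j : Fin N) (f : A.Fn) : A.pd i (A.pd j f) = A.pd j (A.pd i f) := by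
  ext x
  have hd : DifferentiableAt ℝ (fderiv ℝ (f : (Fin N → ℝ) → ℂ)) x :=
    (((contDiff_coe f).fderiv_right (m := 1) (WithTop.coe_le_coe.2 (le_top : (2 : ℕ∞) ≤ ⊤))).differentiable
      (by simp)) x
  have hs : IsSymmSndFDerivAt ℝ (f : (Fin N → ℝ) → ℂ) x :=
    ((contDiff_coe f).contDiffAt).isSymmSndFDerivAt
      (by simpa using WithTop.coe_le_coe.2 (le_top : (2 : ℕ∞) ≤ ⊤))
  have key : ∀ v w : Fin N → ℝ,
      fderiv ℝ (fun y => fderiv ℝ (f : (Fin N → ℝ) → ℂ) y v) x w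
        = fderiv ℝ (fderiv ℝ (f : (Fin N → ℝ) → ℂ)) x w v := by
    intro v w
    rw [fderiv_clm_apply hd (differentiableAt_const v)]
    simp
  change fderiv ℝ (fun y => fderiv ℝ (f : (Fin N → ℝ) → ℂ) y _) x _
    = fderiv ℝ (fun y => fderiv ℝ (f : (Fin N → ℝ) → ℂ) y _) x _
  rw [key, key]
  exact hs _ _

theorem star_coord (i : Fin N) : star (A.coord i) = A.coord i := by
  ext x
  change star (((x i : ℝ) : ℂ)) = ((x i : ℝ) : ℂ)
  simp

end Calculus

end FunctionAlgebra

/-! ### Real affine functions. -/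

namespace FunctionAlgebra

variable {N : ℕ} {A : FunctionAlgebra N}

/-- Affine functions with real coefficients. -/
def IsAffine (l : A.Fn) : Prop :=
  ∃ (ξ : Fin N → ℝ) (c : ℝ), l = ∑ i, (ξ i : ℂ) • A.coord i + (c : ℂ) • (1 : A.Fn)

theorem isAffine_coord (i : Fin N) : IsAffine (A.coord i) :=
  ⟨Pi.single i 1, 0, by simp [Pi.single_apply, ite_smul, apply_ite]⟩

theorem isAffine_const (c : ℝ) : IsAffine ((c : ℂ) • (1 : A.Fn)) :=
  ⟨0, c, by simp⟩

theorem IsAffine.add {l m : A.Fn} (hl : IsAffine l) (hm : IsAffine m) : IsAffine (l + m) := by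
  obtain ⟨ξ, c, rfl⟩ := hl
  obtain ⟨η, d, rfl⟩ := hm
  refine ⟨ξ + η, c + d, ?_⟩
  simp only [Pi.add_apply, Complex.ofReal_add, add_smul, Finset.sum_add_distrib]
  abel

theorem IsAffine.smul (t : ℝ) {l : A.Fn} (hl : IsAffine l) : IsAffine ((t : ℂ) • l) := by
  obtain ⟨ξ, c, rfl⟩ := hl
  refine ⟨fun i => t * ξ i, t * c, ?_⟩
  simp only [Complex.ofReal_mul, mul_smul, smul_add, Finset.smul_sum]

theorem IsAffine.sub {l m : A.Fn} (hl : IsAffine l) (hm : IsAffine m) : IsAffine (l - m) := by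
  have := hl.add (hm.smul (-1))
  simpa [sub_eq_add_neg] using this

theorem IsAffine.star_eq {l : A.Fn} (hl : IsAffine l) : star l = l := by
  obtain ⟨ξ, c, rfl⟩ := hl
  simp [star_sum, star_coord]

theorem IsAffine.pd_eq {l : A.Fn} (hl : IsAffine l) (i : Fin N) :
    ∃ t : ℝ, A.pd i l = (t : ℂ) • (1 : A.Fn) := by
  obtain ⟨ξ, c, rfl⟩ := hl
  exact ⟨ξ i, by simp [pd_add, pd_sum, pd_smul, pd_coord, pd_one, -Complex.coe_smul]⟩

theorem IsAffine.pd_pd {l : A.Fn} (hl : IsAffine l) (i j : Fin N) :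
    A.pd i (A.pd j l) = 0 := by
  obtain ⟨t, ht⟩ := hl.pd_eq j
  rw [ht, pd_smul, pd_one, smul_zero]

theorem IsAffine.star_pd {l : A.Fn} (hl : IsAffine l) (i : Fin N) :
    star (A.pd i l) = A.pd i l := by
  rw [← pd_star, hl.star_eq]

theorem pdMulti_add {n : ℕ} (J : Fin n → Fin N) (f g : A.Fn) :
    A.pdMulti J (f + g) = A.pdMulti J f + A.pdMulti J g := by
  unfold pdMulti
  induction List.ofFn J with
  | nil => rfl
  | cons i l ih => simp only [List.foldr_cons, ih, pd_add]

theorem pdMulti_smul {n : ℕ} (J : Fin n → Fin N) (c : ℂ) (f : A.Fn) :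
    A.pdMulti J (c • f) = c • A.pdMulti J f := by
  unfold pdMulti
  induction List.ofFn J with
  | nil => rfl
  | cons i l ih => simp only [List.foldr_cons, ih, pd_smul]

end FunctionAlgebra

/-- The ring need not be commutative: the expansion is applied both in `A` and to the left
multiplication operators, which do not commute. -/
theorem pow_sum_smul_eq {R : Type*} [Ring R] [Algebra ℂ R] {N : ℕ} (c : Fin N → ℂ) (X : Fin N → R)
    (n : ℕ) : (∑ i, c i • X i) ^ n =
      ∑ J : Fin n → Fin N, (∏ a, c (J a)) • (List.ofFn fun a => X (J a)).prod := by
  induction n with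
  | zero => simp
  | succ n ih =>
    rw [pow_succ', ih, ← (Fin.consEquiv fun _ : Fin (n + 1) => Fin N).sum_comp,
      Fintype.sum_prod_type, Finset.sum_mul]
    refine Finset.sum_congr rfl fun i _ => ?_
    rw [Finset.mul_sum]
    refine Finset.sum_congr rfl fun J _ => ?_
    simp [Fin.consEquiv, List.ofFn_succ, Fin.prod_univ_succ, mul_smul, smul_comm (c i)]

/-! ### The Weyl and Hermiticity conditions for affine functions. -/

namespace FunctionAlgebra.StarProduct

variable {N : ℕ} {A : FunctionAlgebra N} {P : Fin N → Fin N → A.Fn} (S : A.StarProduct P)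

/-- The bidifferential operator `C_r` as a bilinear map. -/
def bil (r : ℕ) : A.Fn →ₗ[ℂ] A.Fn →ₗ[ℂ] A.Fn :=
  LinearMap.mk₂ ℂ (S.C r)
    (fun f f' g => by
      obtain ⟨m, c, hc⟩ := S.bidiff r
      simp only [hc, pdMulti_add, mul_add, add_mul, Finset.sum_add_distrib])
    (fun t f g => by
      obtain ⟨m, c, hc⟩ := S.bidiff r
      simp only [hc, pdMulti_smul, mul_smul_comm, smul_mul_assoc, Finset.smul_sum])
    (fun f g g' => by
      obtain ⟨m, c, hc⟩ := S.bidiff r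
      simp only [hc, pdMulti_add, mul_add, Finset.sum_add_distrib])
    (fun t f g => by
      obtain ⟨m, c, hc⟩ := S.bidiff r
      simp only [hc, pdMulti_smul, mul_smul_comm, Finset.smul_sum])

theorem bil_apply (r : ℕ) (f g : A.Fn) : S.bil r f g = S.C r f g := rfl

theorem coeff_mul_C (r : ℕ) (f : A.Fn) (G : A.Fn⟦X⟧) :
    PowerSeries.coeff r (S.mul (PowerSeries.C f) G) =
      ∑ p ∈ Finset.HasAntidiagonal.antidiagonal r,
        (Complex.I ^ p.1) • S.bil p.1 f (PowerSeries.coeff p.2 G) := by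
  simp only [mul, starMul, PowerSeries.coeff_mk, bil_apply]
  refine Finset.sum_congr rfl fun p _ => ?_
  rw [Finset.sum_eq_single (0, p.2)]
  · simp
  · rintro ⟨a, b⟩ hab hne
    have ha : a ≠ 0 := by
      rintro rfl
      simp at hab
      simp [hab] at hne
    have : PowerSeries.coeff a (PowerSeries.C f) = 0 := by
      rw [PowerSeries.coeff_C, if_neg ha]
    rw [this, ← bil_apply]
    simp
  · simp

theorem coeff_mul_C_C (r : ℕ) (f g : A.Fn) :
    PowerSeries.coeff r (S.mul (PowerSeries.C f) (PowerSeries.C g)) =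
      (Complex.I ^ r) • S.bil r f g := by
  rw [coeff_mul_C, Finset.sum_eq_single (r, 0)]
  · simp
  · rintro ⟨a, b⟩ hab hne
    have hb : b ≠ 0 := by
      rintro rfl
      simp at hab
      simp [hab] at hne
    rw [PowerSeries.coeff_C, if_neg hb]
    simp
  · simp

theorem bil_zero (f g : A.Fn) : S.bil 0 f g = f * g := by
  rw [bil_apply, S.C_zero]

theorem bil_one_right {r : ℕ} (hr : r ≠ 0) (f : A.Fn) : S.bil r f 1 = 0 := by
  have h := congrArg (PowerSeries.coeff r) (S.star_one f)
  have h2 := S.coeff_mul_C_C r f 1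
  rw [map_one] at h2
  rw [mul, h, PowerSeries.coeff_C, if_neg hr] at h2
  exact ((smul_eq_zero.1 h2.symm).resolve_left (pow_ne_zero _ Complex.I_ne_zero))

theorem bil_one_left {r : ℕ} (hr : r ≠ 0) (f : A.Fn) : S.bil r 1 f = 0 := by
  have h := congrArg (PowerSeries.coeff r) (S.one_star f)
  have h2 := S.coeff_mul_C_C r 1 f
  rw [map_one] at h2
  rw [mul, h, PowerSeries.coeff_C, if_neg hr] at h2
  exact ((smul_eq_zero.1 h2.symm).resolve_left (pow_ne_zero _ Complex.I_ne_zero))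

theorem coeff_smul_complex (r : ℕ) (c : ℂ) (F : A.Fn⟦X⟧) :
    PowerSeries.coeff r (c • F) = c • PowerSeries.coeff r F := rfl

/-- Left multiplication by `f ∈ A` as an operator on `A⟦α⟧`. -/
def leftMul : A.Fn →ₗ[ℂ] Module.End ℂ A.Fn⟦X⟧ :=
  LinearMap.mk₂ ℂ (fun f G => S.mul (PowerSeries.C f) G)
    (fun f f' G => by
      ext1 r
      simp only [coeff_mul_C, (S.bil _).map_add, LinearMap.add_apply, smul_add,
        Finset.sum_add_distrib, map_add (PowerSeries.coeff r)])
    (fun c f G => by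
      ext1 r
      rw [coeff_smul_complex]
      simp only [coeff_mul_C, map_smul, LinearMap.smul_apply, Finset.smul_sum, smul_comm c])
    (fun f G G' => by
      ext1 r; simp only [coeff_mul_C, map_add, smul_add, Finset.sum_add_distrib])
    (fun c f G => by
      ext1 r
      simp only [coeff_smul_complex, coeff_mul_C, map_smul, Finset.smul_sum, smul_comm c])

theorem leftMul_apply (f : A.Fn) (G : A.Fn⟦X⟧) :
    S.leftMul f G = S.mul (PowerSeries.C f) G := rfl

theorem leftMul_one : S.leftMul 1 = 1 := by
  ext1 G
  ext1 r
  rw [leftMul_apply, coeff_mul_C, Finset.sum_eq_single (0, r)]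
  · simp [bil_zero]
  · rintro ⟨a, b⟩ hab hne
    have ha : a ≠ 0 := by
      rintro rfl
      simp at hab
      simp [hab] at hne
    rw [S.bil_one_left ha, smul_zero]
  · simp

theorem nested_ofFn {n : ℕ} (J : Fin n → Fin N) (F : A.Fn⟦X⟧) :
    S.nested (List.ofFn J) F = (List.ofFn fun a => S.leftMul (A.coord (J a))).prod F := by
  have : ∀ l : List (Fin N),
      S.nested l F = (l.map fun i => S.leftMul (A.coord i)).prod F := by
    intro l
    induction l with
    | nil => simp [nested]
    | cons i l ih =>
      rw [List.map_cons, List.prod_cons, Module.End.mul_apply, ← ih]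
      rfl
  rw [this, List.map_ofFn]
  rfl

variable {S}

/-- Contracting the Weyl condition with ξ in every index absorbs the symmetrization, since the
coefficient products are already symmetric. -/
theorem IsWeyl.leftMul_linear_pow (hW : S.IsWeyl) (ξ : Fin N → ℂ) (n : ℕ) (g : A.Fn) :
    S.leftMul ((∑ i, ξ i • A.coord i) ^ n) (PowerSeries.C g) =
      (S.leftMul (∑ i, ξ i • A.coord i) ^ n) (PowerSeries.C g) := by
  have hW' : ∀ J : Fin n → Fin N,
      S.leftMul (∏ a, A.coord (J a)) (PowerSeries.C g) = (1 / (n.factorial : ℂ)) •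
        ∑ σ : Equiv.Perm (Fin n),
          (List.ofFn fun a => S.leftMul (A.coord (J (σ a)))).prod (PowerSeries.C g) := by
    intro J
    rw [leftMul_apply, hW n J g]
    simp only [nested_ofFn]
  -- Reindexing the multi-indices by σ leaves the scalar product unchanged, so all n! permutations
  -- contribute the same operator power and the factor 1/n! cancels.
  have hsum : ∀ σ : Equiv.Perm (Fin n),
      ∑ J : Fin n → Fin N, (∏ a, ξ (J a)) •
        (List.ofFn fun a => S.leftMul (A.coord (J (σ a)))).prod (PowerSeries.C g) =
      (S.leftMul (∑ i, ξ i • A.coord i) ^ n) (PowerSeries.C g) := by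
    intro σ
    simp only [map_sum, map_smul]
    rw [pow_sum_smul_eq (R := Module.End ℂ A.Fn⟦X⟧), LinearMap.sum_apply,
      ← (Equiv.arrowCongr σ (Equiv.refl (Fin N))).sum_comp]
    refine Finset.sum_congr rfl fun J _ => ?_
    simp only [Equiv.arrowCongr_apply, Function.comp, Equiv.refl_apply, LinearMap.smul_apply,
      Equiv.symm_apply_apply]
    congr 1
    exact Equiv.prod_comp σ.symm (fun a => ξ (J a))
  rw [pow_sum_smul_eq]
  simp only [map_sum (S.leftMul), map_smul (S.leftMul), LinearMap.sum_apply, LinearMap.smul_apply,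
    List.prod_ofFn, hW', Finset.smul_sum]
  rw [Finset.sum_comm]
  simp only [smul_comm _ (1 / (n.factorial : ℂ)), ← Finset.smul_sum]
  simp only [← List.prod_ofFn, map_sum, map_smul] at hsum
  simp only [← List.prod_ofFn, hsum, Finset.sum_const, Finset.card_univ, Fintype.card_perm,
    Fintype.card_fin]
  rw [← Nat.cast_smul_eq_nsmul ℂ, smul_smul, one_div,
    inv_mul_cancel₀ (Nat.cast_ne_zero.2 n.factorial_ne_zero), one_smul]

theorem IsWeyl.leftMul_pow (hW : S.IsWeyl) {l : A.Fn} (hl : IsAffine l) (n : ℕ) (g : A.Fn) :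
    S.leftMul (l ^ n) (PowerSeries.C g) = (S.leftMul l ^ n) (PowerSeries.C g) := by
  obtain ⟨ξ, c, rfl⟩ := hl
  set l₀ : A.Fn := ∑ i, (ξ i : ℂ) • A.coord i with hl₀
  have key : ∀ q : Polynomial ℂ, S.leftMul (Polynomial.aeval l₀ q) (PowerSeries.C g) =
      (Polynomial.aeval (S.leftMul l₀) q) (PowerSeries.C g) := by
    intro q
    induction q using Polynomial.induction_on' with
    | add p q hp hq => simp only [map_add, LinearMap.add_apply, hp, hq]
    | monomial k a =>
      simp only [Polynomial.aeval_monomial, ← Algebra.smul_def, map_smul, LinearMap.smul_apply]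
      rw [hl₀, hW.leftMul_linear_pow]
  -- The constant c acts by the scalar c because 1 is a left unit, so the affine case is a
  -- polynomial identity in the linear part.
  have h := key ((Polynomial.X + Polynomial.C (c : ℂ)) ^ n)
  simpa [Algebra.algebraMap_eq_smul_one, map_add, map_smul, leftMul_one, -Complex.coe_smul] using h

/-- The Weyl condition for powers of affine functions, order by order. -/
theorem IsWeyl.bil_pow_succ (hW : S.IsWeyl) {l : A.Fn} (hl : IsAffine l) (r n : ℕ) (g : A.Fn) :
    S.bil r (l ^ (n + 1)) g =
      ∑ p ∈ Finset.HasAntidiagonal.antidiagonal r, S.bil p.1 l (S.bil p.2 (l ^ n) g) := by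
  have h : S.leftMul (l ^ (n + 1)) (PowerSeries.C g) =
      S.leftMul l (S.leftMul (l ^ n) (PowerSeries.C g)) := by
    rw [hW.leftMul_pow hl, hW.leftMul_pow hl, pow_succ', Module.End.mul_apply]
  have h2 := congrArg (PowerSeries.coeff r) h
  simp only [leftMul_apply] at h2
  rw [coeff_mul_C_C, coeff_mul_C] at h2
  have h3 : ∀ p ∈ Finset.HasAntidiagonal.antidiagonal r,
      Complex.I ^ p.1 • S.bil p.1 l (PowerSeries.coeff p.2
        (S.mul (PowerSeries.C (l ^ n)) (PowerSeries.C g))) =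
      Complex.I ^ r • S.bil p.1 l (S.bil p.2 (l ^ n) g) := by
    intro p hp
    rw [coeff_mul_C_C, map_smul, smul_smul, ← pow_add, Finset.HasAntidiagonal.mem_antidiagonal.1 hp]
  rw [Finset.sum_congr rfl h3, ← Finset.smul_sum] at h2
  exact smul_right_injective _ (pow_ne_zero r Complex.I_ne_zero) h2

/-- Acting on 1, left multiplication by l^n produces l^n itself, so the power rule reads l ⋆ l^n =
l^(n+1), without corrections. -/
theorem IsWeyl.bil_pow (hW : S.IsWeyl) {l : A.Fn} (hl : IsAffine l) {r : ℕ} (hr : r ≠ 0) (n : ℕ) :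
    S.bil r l (l ^ n) = 0 := by
  have h := hW.leftMul_pow hl (n + 1) 1
  rw [pow_succ' (S.leftMul l), Module.End.mul_apply, ← hW.leftMul_pow hl, pow_succ'] at h
  have h1 : S.leftMul (l ^ n) (PowerSeries.C 1) = PowerSeries.C (l ^ n) := by
    rw [map_one]; exact S.star_one _
  rw [h1] at h
  have h2 := congrArg (PowerSeries.coeff r) h
  simp only [leftMul_apply, coeff_mul_C_C, S.bil_one_right hr, smul_zero] at h2
  exact (smul_eq_zero.1 h2.symm).resolve_left (pow_ne_zero _ Complex.I_ne_zero)

/-- The sign comes from conjugating i^r. The condition for coordinates passes to affine l because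
their linear coefficients are real and constants do not contribute for r > 0. -/
theorem IsWeaklyHermitian.bil_right (hH : S.IsWeaklyHermitian) {l : A.Fn} (hl : IsAffine l)
    {r : ℕ} (hr : r ≠ 0) {f : A.Fn} (hf : star f = f) :
    S.bil r f l = (-1 : ℂ) ^ r • star (S.bil r l f) := by
  have hc : ∀ j, S.bil r f (A.coord j) = (-1 : ℂ) ^ r • star (S.bil r (A.coord j) f) := by
    intro j
    have h := congrArg (PowerSeries.coeff r) (hH j f)
    rw [PowerSeries.coeff_map, coeff_mul_C_C, coeff_mul_C_C, hf] at h
    rw [starRingEnd_apply, star_smul, star_pow, Complex.star_def, Complex.conj_I] at h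
    apply smul_right_injective _ (pow_ne_zero r Complex.I_ne_zero)
    simp only
    rw [← h, smul_smul, ← mul_pow]
    simp
  obtain ⟨ξ, c, rfl⟩ := hl
  simp only [map_add, map_sum, map_smul, LinearMap.add_apply, LinearMap.sum_apply,
    LinearMap.smul_apply, S.bil_one_right hr, S.bil_one_left hr, smul_zero, add_zero, hc,
    star_sum, star_smul, Finset.smul_sum, Complex.star_def, Complex.conj_ofReal]
  refine Finset.sum_congr rfl fun i _ => ?_
  rw [smul_comm]

end FunctionAlgebra.StarProduct

/-! ### Jets at a point, Taylor polynomials and polarization. -/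

namespace FunctionAlgebra

variable {N : ℕ} {A : FunctionAlgebra N}

/-- Evaluation at a point. -/
def evalAt (x : Fin N → ℝ) : A.Fn →ₐ[ℂ] ℂ :=
  (Pi.evalAlgHom ℂ (fun _ : Fin N → ℝ => ℂ) x).comp A.carrier.toSubalgebra.val

theorem evalAt_apply (x : Fin N → ℝ) (f : A.Fn) : evalAt x f = (f : (Fin N → ℝ) → ℂ) x := rfl

theorem ext_evalAt {f g : A.Fn} (h : ∀ x, evalAt x f = evalAt x g) : f = g :=
  Subtype.ext (funext h)

/-- The coordinates centred at a point. -/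
def centred (A : FunctionAlgebra N) (x : Fin N → ℝ) (i : Fin N) : A.Fn :=
  A.coord i - ((x i : ℝ) : ℂ) • (1 : A.Fn)

theorem isAffine_centred (x : Fin N → ℝ) (i : Fin N) :
    IsAffine (A.centred x i) :=
  (isAffine_coord i).sub (isAffine_const _)

theorem evalAt_centred (x : Fin N → ℝ) (i : Fin N) :
    evalAt x (A.centred x i) = 0 := by
  rw [centred, map_sub, map_smul, map_one, evalAt_apply]
  simp [coord]

theorem pd_centred (x : Fin N → ℝ) (i j : Fin N) :
    A.pd i (A.centred x j) = (if i = j then (1 : ℂ) else 0) • (1 : A.Fn) := by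
  rw [centred, pd_sub, pd_smul, pd_one, pd_coord]
  split_ifs <;> simp

/-- The Taylor polynomial of degree three. -/
def taylorThree (x : Fin N → ℝ) (f : A.Fn) : A.Fn :=
  evalAt x f • (1 : A.Fn) + ∑ i, evalAt x (A.pd i f) • A.centred x i
    + (1 / 2 : ℂ) • ∑ i, ∑ j, evalAt x (A.pd i (A.pd j f)) • (A.centred x i * A.centred x j)
    + (1 / 6 : ℂ) • ∑ i, ∑ j, ∑ k, evalAt x (A.pd i (A.pd j (A.pd k f))) •
        (A.centred x i * A.centred x j * A.centred x k)

theorem map_mul_eq_zero_of_sq {x : Fin N → ℝ} (L : A.Fn →ₗ[ℂ] ℂ)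
    (h : ∀ l : A.Fn, IsAffine l → evalAt x l = 0 → L (l ^ 2) = 0) {l m : A.Fn}
    (hl : IsAffine l) (hm : IsAffine m) (hl0 : evalAt x l = 0) (hm0 : evalAt x m = 0) :
    L (l * m) = 0 := by
  have e : l * m = (1 / 4 : ℂ) • ((l + m) ^ 2 - (l - m) ^ 2) := by
    rw [show (l + m) ^ 2 - (l - m) ^ 2 = (4 : ℂ) • (l * m) by
      rw [ofNat_smul_eq_nsmul, nsmul_eq_mul]; push_cast; ring, smul_smul]
    norm_num
  rw [e, map_smul, map_sub, h _ (hl.add hm) (by simp [hl0, hm0]),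
    h _ (hl.sub hm) (by simp [hl0, hm0])]
  simp

theorem map_mul_mul_eq_zero_of_cube {x : Fin N → ℝ} (L : A.Fn →ₗ[ℂ] ℂ)
    (h : ∀ l : A.Fn, IsAffine l → evalAt x l = 0 → L (l ^ 3) = 0) {l m k : A.Fn}
    (hl : IsAffine l) (hm : IsAffine m) (hk : IsAffine k) (hl0 : evalAt x l = 0)
    (hm0 : evalAt x m = 0) (hk0 : evalAt x k = 0) :
    L (l * m * k) = 0 := by
  have e : l * m * k = (1 / 24 : ℂ) •
      ((l + m + k) ^ 3 - (l + m - k) ^ 3 - (l - m + k) ^ 3 + (l - m - k) ^ 3) := by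
    rw [show (l + m + k) ^ 3 - (l + m - k) ^ 3 - (l - m + k) ^ 3 + (l - m - k) ^ 3
        = (24 : ℂ) • (l * m * k) by
      rw [ofNat_smul_eq_nsmul, nsmul_eq_mul]; push_cast; ring, smul_smul]
    norm_num
  rw [e, map_smul, map_add, map_sub, map_sub,
    h _ ((hl.add hm).add hk) (by simp [hl0, hm0, hk0]),
    h _ ((hl.add hm).sub hk) (by simp [hl0, hm0, hk0]),
    h _ ((hl.sub hm).add hk) (by simp [hl0, hm0, hk0]),
    h _ ((hl.sub hm).sub hk) (by simp [hl0, hm0, hk0])]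
  simp

/-- By the Leibniz rule a derivative lowers the order of vanishing at x by at most one. Orders are
measured by powers of the maximal ideal of x in `A`. -/
theorem pd_mem_pow {x : Fin N → ℝ} (i : Fin N) (n : ℕ) {f : A.Fn}
    (hf : f ∈ RingHom.ker (evalAt (A := A) x) ^ (n + 1)) :
    A.pd i f ∈ RingHom.ker (evalAt (A := A) x) ^ n := by
  induction n generalizing f with
  | zero => simp
  | succ n ih =>
    rw [pow_succ] at hf
    refine Submodule.mul_induction_on hf (fun g hg k hk => ?_) (fun g k hg hk => ?_)
    · rw [pd_mul]
      refine Ideal.add_mem _ (Ideal.mul_mem_right _ _ hg) ?_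
      rw [pow_succ']
      exact Ideal.mul_mem_mul hk (ih hg)
    · rw [pd_add]
      exact Ideal.add_mem _ hg hk

/-- The functionals on `A` that are linear in the derivatives of order at most `n` at a point. -/
inductive JetForm (x : Fin N → ℝ) (n : ℕ) : (A.Fn → ℂ) → Prop
  | deriv (l : List (Fin N)) (hl : l.length ≤ n) :
      JetForm x n (fun f => evalAt x (l.foldr A.pd f))
  | zero : JetForm x n (fun _ => 0)
  | add {φ ψ : A.Fn → ℂ} : JetForm x n φ → JetForm x n ψ → JetForm x n (fun f => φ f + ψ f)
  | const_mul (c : ℂ) {φ : A.Fn → ℂ} : JetForm x n φ → JetForm x n (fun f => c * φ f)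

namespace JetForm

variable {x : Fin N → ℝ} {n : ℕ} {φ ψ : A.Fn → ℂ}

theorem sum {ι : Type*} (s : Finset ι) {φ : ι → A.Fn → ℂ} (h : ∀ a, JetForm x n (φ a)) :
    JetForm x n (fun f => ∑ a ∈ s, φ a f) := by
  classical
  induction s using Finset.induction_on with
  | empty => simpa using JetForm.zero
  | insert a s ha ih => simpa [Finset.sum_insert ha] using (h a).add ih

theorem mul_const (h : JetForm x n φ) (c : ℂ) : JetForm x n (fun f => φ f * c) := by
  simpa only [mul_comm] using h.const_mul c

theorem neg (h : JetForm x n φ) : JetForm x n (fun f => -φ f) := by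
  simpa using h.const_mul (-1)

theorem sub (h : JetForm x n φ) (h' : JetForm x n ψ) : JetForm x n (fun f => φ f - ψ f) := by
  simpa only [sub_eq_add_neg] using h.add h'.neg

theorem deriv_one (hn : 1 ≤ n) (i : Fin N) : JetForm x n (fun f => evalAt x (A.pd i f)) :=
  deriv [i] (by simpa)

theorem deriv_two (hn : 2 ≤ n) (i j : Fin N) :
    JetForm x n (fun f => evalAt x (A.pd i (A.pd j f))) :=
  deriv [i, j] (by simpa)

theorem deriv_three (hn : 3 ≤ n) (i j k : Fin N) :
    JetForm x n (fun f => evalAt x (A.pd i (A.pd j (A.pd k f)))) :=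
  deriv [i, j, k] (by simpa)

theorem map_add' (h : JetForm x n φ) (f g : A.Fn) : φ (f + g) = φ f + φ g := by
  induction h with
  | deriv l hl =>
    have : l.foldr A.pd (f + g) = l.foldr A.pd f + l.foldr A.pd g := by
      clear hl
      induction l with
      | nil => rfl
      | cons i l ih => simp only [List.foldr_cons, ih, pd_add]
    beta_reduce
    rw [this, map_add]
  | zero => simp
  | add _ _ h1 h2 => beta_reduce; rw [h1, h2]; ring
  | const_mul c _ h1 => beta_reduce; rw [h1]; ring

theorem map_smul' (h : JetForm x n φ) (c : ℂ) (f : A.Fn) : φ (c • f) = c * φ f := by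
  induction h with
  | deriv l hl =>
    have : l.foldr A.pd (c • f) = c • l.foldr A.pd f := by
      clear hl
      induction l with
      | nil => rfl
      | cons i l ih => simp only [List.foldr_cons, ih, pd_smul]
    beta_reduce
    rw [this, map_smul, smul_eq_mul]
  | zero => simp
  | add _ _ h1 h2 => beta_reduce; rw [h1, h2]; ring
  | const_mul c _ h1 => beta_reduce; rw [h1]; ring

/-- A jet form as a linear map. -/
def toLinearMap (h : JetForm x n φ) : A.Fn →ₗ[ℂ] ℂ := ⟨⟨φ, h.map_add'⟩, h.map_smul'⟩

theorem toLinearMap_apply (h : JetForm x n φ) (f : A.Fn) : h.toLinearMap f = φ f := rfl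

theorem apply_eq_zero_of_mem (h : JetForm x n φ) {f : A.Fn}
    (hf : f ∈ RingHom.ker (evalAt (A := A) x) ^ (n + 1)) : φ f = 0 := by
  induction h with
  | deriv L hL =>
    have key : ∀ L : List (Fin N), L.length ≤ n →
        L.foldr A.pd f ∈ RingHom.ker (evalAt (A := A) x) ^ (n + 1 - L.length) := by
      intro L
      induction L with
      | nil => intro _; simpa using hf
      | cons i L ih =>
        intro hL
        rw [List.length_cons] at hL ⊢
        refine pd_mem_pow i _ ?_
        rw [show n + 1 - (L.length + 1) + 1 = n + 1 - L.length by omega]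
        exact ih (by omega)
    have h1 := Ideal.pow_le_self (by omega) (key L hL)
    exact h1
  | zero => rfl
  | add _ _ h1 h2 => beta_reduce; rw [h1, h2, add_zero]
  | const_mul c _ h1 => beta_reduce; rw [h1, mul_zero]

theorem apply_pow_of_lt (h : JetForm x n φ) {l : A.Fn} (hl : evalAt x l = 0) {a : ℕ}
    (ha : n < a) : φ (l ^ a) = 0 :=
  h.apply_eq_zero_of_mem (Ideal.pow_le_pow_right ha (Ideal.pow_mem_pow hl a))

/-- Only the equality of derivatives up to order three at x matters; no remainder has to be
estimated or shown to lie in an ideal of `A`. -/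
theorem apply_taylorThree (hn : n ≤ 3) (h : JetForm x n φ) (f : A.Fn) :
    φ (taylorThree x f) = φ f := by
  induction h with
  | deriv L hL =>
    have h3 : L.length ≤ 3 := hL.trans hn
    match L, h3 with
    | [], _ => simp [taylorThree, evalAt_centred]
    | [a], _ =>
      simp [taylorThree, evalAt_centred, pd_add, pd_smul, pd_one, pd_sum, pd_mul, pd_centred,
        apply_ite (evalAt x)]
    | [a, b], _ =>
      simp [taylorThree, evalAt_centred, pd_add, pd_smul, pd_one, pd_sum, pd_mul, pd_centred,
        Finset.sum_add_distrib, mul_add, pd_comm b a]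
      ring
    | [a, b, c], _ =>
      simp [taylorThree, pd_add, pd_smul, pd_one, pd_sum, pd_mul, pd_centred,
        Finset.sum_add_distrib, mul_add]
      simp [pd_comm b a, pd_comm c a, pd_comm c b]
      ring
  | zero => rfl
  | add _ _ h1 h2 => beta_reduce; rw [h1, h2]
  | const_mul c _ h1 => beta_reduce; rw [h1]

/-- A jet form of order at most three vanishes if it does on the powers of affine functions. -/
theorem eq_zero (hn : n ≤ 3) (h : JetForm x n φ)
    (h0 : ∀ l : A.Fn, IsAffine l → evalAt x l = 0 → ∀ a ≤ n, φ (l ^ a) = 0) (f : A.Fn) :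
    φ f = 0 := by
  have h0' : ∀ l : A.Fn, IsAffine l → evalAt x l = 0 → ∀ a, h.toLinearMap (l ^ a) = 0 := by
    intro l hl hl0 a
    rcases le_or_gt a n with ha | ha
    · exact h0 l hl hl0 a ha
    · exact h.apply_pow_of_lt hl0 ha
  rw [← h.apply_taylorThree hn f, ← h.toLinearMap_apply]
  have h1 : h.toLinearMap 1 = 0 := by
    -- The constant 1 is obtained as the zeroth power of the affine function 0.
    simpa using h0' 0 (by simpa using isAffine_const (A := A) 0) (by simp) 0
  have hx := fun i => isAffine_centred (A := A) x i
  have hx0 := fun i => evalAt_centred (A := A) x i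
  have h2 : ∀ i, h.toLinearMap (A.centred x i) = 0 := fun i => by
    simpa using h0' _ (hx i) (hx0 i) 1
  have h3 : ∀ i j, h.toLinearMap (A.centred x i * A.centred x j) = 0 := fun i j =>
    map_mul_eq_zero_of_sq _ (fun l hl hl0 => h0' l hl hl0 2) (hx i) (hx j) (hx0 i) (hx0 j)
  have h4 : ∀ i j k, h.toLinearMap (A.centred x i * A.centred x j * A.centred x k) = 0 :=
    fun i j k => map_mul_mul_eq_zero_of_cube _ (fun l hl hl0 => h0' l hl hl0 3) (hx i) (hx j)
      (hx k) (hx0 i) (hx0 j) (hx0 k)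
  simp only [taylorThree, map_add, map_smul, map_sum, h1, h2, h3, h4, smul_zero,
    Finset.sum_const_zero, add_zero]

end JetForm

theorem IsBidiff.jetForm_left {m : ℕ} {B : A.Fn → A.Fn → A.Fn} (hB : A.IsBidiff m B)
    (x : Fin N → ℝ) (g : A.Fn) : JetForm x m (fun f => evalAt x (B f g)) := by
  obtain ⟨c, hc⟩ := hB
  simp only [hc, map_sum, map_mul, Finset.sum_range]
  exact .sum _ fun a => .sum _ fun b => .sum _ fun I => .sum _ fun J =>
    ((JetForm.deriv (List.ofFn I) (by simp; omega)).const_mul _).mul_const _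

theorem IsBidiff.jetForm_right {m : ℕ} {B : A.Fn → A.Fn → A.Fn} (hB : A.IsBidiff m B)
    (x : Fin N → ℝ) (f : A.Fn) : JetForm x m (fun g => evalAt x (B f g)) := by
  obtain ⟨c, hc⟩ := hB
  simp only [hc, map_sum, map_mul, Finset.sum_range]
  exact .sum _ fun a => .sum _ fun b => .sum _ fun I => .sum _ fun J =>
    (JetForm.deriv (List.ofFn J) (by simp; omega)).const_mul _

end FunctionAlgebra

theorem Fin.sum_pi_succ {N n : ℕ} {M : Type*} [AddCommMonoid M]
    (F : (Fin (n + 1) → Fin N) → M) :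
    ∑ J, F J = ∑ i, ∑ J : Fin n → Fin N, F (Matrix.vecCons i J) := by
  rw [← (Fin.consEquiv fun _ : Fin (n + 1) => Fin N).sum_comp, Fintype.sum_prod_type]
  rfl

theorem Fin.default_pi_zero {N : ℕ} : (default : Fin 0 → Fin N) = ![] := Subsingleton.elim _ _

/-! ### The first-order operator, and second order on affine functions. -/

namespace FunctionAlgebra

variable {N : ℕ} {A : FunctionAlgebra N}

theorem IsAffine.linearMap_apply (L : A.Fn →ₗ[ℂ] A.Fn) (hL : L 1 = 0) {l : A.Fn}
    (hl : IsAffine l) : L l = ∑ i, A.pd i l * L (A.coord i) := by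
  obtain ⟨ξ, c, rfl⟩ := hl
  simp [pd_add, pd_sum, pd_smul, pd_coord, pd_one, hL, -Complex.coe_smul]

theorem IsAffine.mul_linearMap_apply {l : A.Fn} (hl : IsAffine l) (i : Fin N)
    (L : A.Fn →ₗ[ℂ] A.Fn) (f : A.Fn) : L (A.pd i l * f) = A.pd i l * L f := by
  obtain ⟨t, ht⟩ := hl.pd_eq i
  rw [ht]
  simp [-Complex.coe_smul]

namespace StarProduct

variable {P : Fin N → Fin N → A.Fn} {S : A.StarProduct P}

theorem HasCoeffs.bil_coord {Γ : ℕ → (n : ℕ) → Fin N → (Fin n → Fin N) → A.Fn}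
    (hΓ : S.HasCoeffs Γ) {r : ℕ} (hr : 1 ≤ r) (i : Fin N) (g : A.Fn) :
    S.bil r (A.coord i) g =
      ∑ n ∈ Finset.Icc 1 r, ∑ J : Fin n → Fin N, Γ (r - n) n i J * A.pdMulti J g := by
  have h := hΓ.expansion i g r hr
  rw [coeff_mul_C_C] at h
  exact smul_right_injective _ (pow_ne_zero r Complex.I_ne_zero) h

section Expansion

variable {Γ : ℕ → (n : ℕ) → Fin N → (Fin n → Fin N) → A.Fn} (hΓ : S.HasCoeffs Γ)
include hΓ

theorem HasCoeffs.bil_one_coord (i : Fin N) (g : A.Fn) :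
    S.bil 1 (A.coord i) g = ∑ j, Γ 0 1 i ![j] * A.pd j g := by
  rw [hΓ.bil_coord le_rfl]
  simp [Fin.sum_pi_succ, Fin.default_pi_zero, pdMulti]

theorem HasCoeffs.bil_two_coord (i : Fin N) (g : A.Fn) :
    S.bil 2 (A.coord i) g = ∑ j, Γ 1 1 i ![j] * A.pd j g +
      ∑ j, ∑ k, Γ 0 2 i ![j, k] * A.pd j (A.pd k g) := by
  rw [hΓ.bil_coord (by norm_num), Finset.sum_Icc_succ_top (by norm_num)]
  simp [Fin.sum_pi_succ, Fin.default_pi_zero, pdMulti]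

theorem HasCoeffs.bil_three_coord (i : Fin N) (g : A.Fn) :
    S.bil 3 (A.coord i) g = ∑ j, Γ 2 1 i ![j] * A.pd j g +
      ∑ j, ∑ k, Γ 1 2 i ![j, k] * A.pd j (A.pd k g) +
      ∑ j, ∑ k, ∑ l, Γ 0 3 i ![j, k, l] * A.pd j (A.pd k (A.pd l g)) := by
  rw [hΓ.bil_coord (by norm_num), Finset.sum_Icc_succ_top (by norm_num),
    Finset.sum_Icc_succ_top (by norm_num)]
  simp [Fin.sum_pi_succ, Fin.default_pi_zero, pdMulti]

end Expansion

/-- The hypotheses that determine the star product. -/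
structure IsAdmissible (S : A.StarProduct P) : Prop where
  bivector : A.IsBivector P
  weyl : S.IsWeyl
  hermitian : S.IsWeaklyHermitian
  strict : S.IsStrictlyTriangular

namespace IsAdmissible

variable (h : S.IsAdmissible) {l m k : A.Fn}
include h

/-- The Weyl condition gives C_1(l, l) = 0, so C_1 has no symmetric part on coordinates;
quantization fixes the antisymmetric part. -/
theorem bil_one_coord_coord (i j : Fin N) : S.bil 1 (A.coord i) (A.coord j) = P i j := by
  have hb : A.bracket P (A.coord i) (A.coord j) = P i j := by
    simp [bracket, pd_coord]
  have hq := S.quantizes (A.coord i) (A.coord j)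
  rw [hb, ← bil_apply, ← bil_apply] at hq
  have hs : ∀ l : A.Fn, IsAffine l → S.bil 1 l l = 0 := fun l hl => by
    simpa using h.weyl.bil_pow hl one_ne_zero 1
  have h1 := hs _ ((isAffine_coord i).add (isAffine_coord j))
  simp only [map_add, LinearMap.add_apply, hs _ (isAffine_coord i), hs _ (isAffine_coord j)] at h1
  linear_combination (norm := algebra) (1 / 2 : ℂ) • hq + (1 / 2 : ℂ) • h1

theorem bil_one_coord (i : Fin N) (g : A.Fn) :
    S.bil 1 (A.coord i) g = ∑ j, P i j * A.pd j g := by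
  obtain ⟨-, Γ, hΓ, -⟩ := h.strict
  have : ∀ j, Γ 0 1 i ![j] = P i j := fun j => by
    rw [← h.bil_one_coord_coord, hΓ.bil_one_coord]
    simp [pd_coord]
  simp only [hΓ.bil_one_coord, this]

theorem bil_one (hl : IsAffine l) (g : A.Fn) :
    S.bil 1 l g = ∑ i, ∑ j, A.pd i l * P i j * A.pd j g := by
  have := hl.linearMap_apply ((S.bil 1).flip g) (S.bil_one_left one_ne_zero g)
  simp only [LinearMap.flip_apply, h.bil_one_coord, Finset.mul_sum] at this
  simpa only [mul_assoc] using this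

theorem bil_one_eq_sum (hl : IsAffine l) (g : A.Fn) :
    S.bil 1 l g = ∑ j, S.bil 1 l (A.coord j) * A.pd j g := by
  simp only [h.bil_one hl, pd_coord, mul_ite, mul_one, mul_zero, Finset.sum_ite_eq',
    Finset.mem_univ, if_true, Finset.sum_mul]
  rw [Finset.sum_comm]

theorem bil_one_mul (hl : IsAffine l) (f g : A.Fn) :
    S.bil 1 l (f * g) = f * S.bil 1 l g + g * S.bil 1 l f := by
  rw [h.bil_one_eq_sum hl, h.bil_one_eq_sum hl f, h.bil_one_eq_sum hl g]
  simp only [Finset.mul_sum, ← Finset.sum_add_distrib, pd_mul]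
  exact Finset.sum_congr rfl fun j _ => by ring

theorem bil_one_self (hl : IsAffine l) : S.bil 1 l l = 0 := by
  simpa using h.weyl.bil_pow hl one_ne_zero 1

theorem bil_one_antisymm (hl : IsAffine l) (hm : IsAffine m) : S.bil 1 l m = -S.bil 1 m l := by
  have h1 := h.bil_one_self (hl.add hm)
  simp only [map_add, LinearMap.add_apply, h.bil_one_self hl, h.bil_one_self hm] at h1
  linear_combination h1

theorem star_bil_one (hl : IsAffine l) (f : A.Fn) : star (S.bil 1 l f) = S.bil 1 l (star f) := by
  simp only [h.bil_one hl, star_sum, star_mul', hl.star_pd, h.bivector.real, pd_star]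

/-- Second derivatives of m vanish, so only Γ_1^{ij} could contribute, and strict triangularity
removes it. -/
theorem bil_two_affine (hl : IsAffine l) (hm : IsAffine m) : S.bil 2 l m = 0 := by
  obtain ⟨-, Γ, hΓ, hs⟩ := h.strict
  have := hl.linearMap_apply ((S.bil 2).flip m) (S.bil_one_left two_ne_zero m)
  simpa [hΓ.bil_two_coord, hs 1 le_rfl, hm.pd_pd, pd_zero] using this

theorem bil_three_affine (hl : IsAffine l) (hm : IsAffine m) : S.bil 3 l m = 0 := by
  obtain ⟨-, Γ, hΓ, hs⟩ := h.strict
  have := hl.linearMap_apply ((S.bil 3).flip m) (S.bil_one_left three_ne_zero m)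
  simpa [hΓ.bil_three_coord, hs 2 one_le_two, hm.pd_pd, pd_zero] using this

/-- This is the part of C_r(l, l^2) = 0 linear in m after replacing l by l ± m. -/
theorem bil_mul_self_eq {r : ℕ} (hr : r ≠ 0) (hl : IsAffine l) (hm : IsAffine m) :
    S.bil r l (l * m) = (-1 / 2 : ℂ) • S.bil r m (l ^ 2) := by
  have e1 := h.weyl.bil_pow (hl.add hm) hr 2
  have e2 := h.weyl.bil_pow (hl.sub hm) hr 2
  rw [show (l + m) ^ 2 = l ^ 2 + (2 : ℂ) • (l * m) + m ^ 2 by algebra] at e1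
  rw [show (l - m) ^ 2 = l ^ 2 - (2 : ℂ) • (l * m) + m ^ 2 by algebra] at e2
  simp only [map_add, map_sub, map_smul, LinearMap.add_apply, LinearMap.sub_apply,
    h.weyl.bil_pow hl hr, h.weyl.bil_pow hm hr] at e1 e2
  linear_combination (norm := algebra) (1 / 4 : ℂ) • e1 - (1 / 4 : ℂ) • e2

theorem bil_sq_mul_eq {r : ℕ} (hr : r ≠ 0) (hl : IsAffine l) (hm : IsAffine m) :
    S.bil r l (l ^ 2 * m) = (-1 / 3 : ℂ) • S.bil r m (l ^ 3) := by
  have key : ∀ t : ℝ, S.bil r l (l ^ 3) + (t : ℂ) • (S.bil r m (l ^ 3) + (3 : ℂ) • S.bil r l (l ^ 2 * m))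
      + ((t : ℂ) ^ 2) • ((3 : ℂ) • S.bil r m (l ^ 2 * m) + (3 : ℂ) • S.bil r l (l * m ^ 2))
      + ((t : ℂ) ^ 3) • ((3 : ℂ) • S.bil r m (l * m ^ 2) + S.bil r l (m ^ 3))
      + ((t : ℂ) ^ 4) • S.bil r m (m ^ 3) = 0 := by
    intro t
    have e1 := h.weyl.bil_pow (hl.add (hm.smul t)) hr 3
    rw [show (l + (t : ℂ) • m) ^ 3 = l ^ 3 + (3 * (t : ℂ)) • (l ^ 2 * m)
      + (3 * (t : ℂ) ^ 2) • (l * m ^ 2) + ((t : ℂ) ^ 3) • m ^ 3 by algebra] at e1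
    simp only [map_add, map_smul, LinearMap.add_apply, LinearMap.smul_apply] at e1
    linear_combination (norm := algebra) e1
  -- The left side of `key` is a quartic polynomial in t that vanishes for all real t; the values at
  -- ±1 and ±2 isolate its linear coefficient.
  have k1 := key 1
  have k2 := key (-1)
  have k3 := key 2
  have k4 := key (-2)
  push_cast at k1 k2 k3 k4
  linear_combination (norm := algebra) (2 / 9 : ℂ) • k1 - (2 / 9 : ℂ) • k2 - (1 / 36 : ℂ) • k3
    + (1 / 36 : ℂ) • k4

/-- With X = C_2(m, l^2) and Q = C_1(l, C_1(l, m)), which is real, the Weyl recursion for C_2(l^2,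
m) reads X* = Q - X/2. Together with its conjugate this forces X = (2/3) Q. -/
theorem bil_two_sq (hl : IsAffine l) (hm : IsAffine m) :
    S.bil 2 m (l ^ 2) = (2 / 3 : ℂ) • S.bil 1 l (S.bil 1 l m) := by
  have e1 := h.weyl.bil_pow_succ hl 2 1 m
  rw [h.hermitian.bil_right hm two_ne_zero (by rw [star_pow, hl.star_eq])] at e1
  simp only [Finset.Nat.antidiagonal_succ] at e1
  simp [bil_zero, h.bil_two_affine hl hm, h.bil_mul_self_eq two_ne_zero hl hm] at e1
  have e2 := congrArg star e1
  simp only [star_star, star_add, star_smul, h.star_bil_one hl, hm.star_eq] at e2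
  simp at e2
  linear_combination (norm := algebra) (4 / 3 : ℂ) • e2 - (2 / 3 : ℂ) • e1

end IsAdmissible

end StarProduct

end FunctionAlgebra

/-! ### The operator C_2(l, ·), and C_3(m, ·) on powers of an affine function. -/

namespace FunctionAlgebra.StarProduct

variable {N : ℕ} {A : FunctionAlgebra N} {P : Fin N → Fin N → A.Fn} {S : A.StarProduct P}

theorem fn_mul_neg (f g : A.Fn) : f * -g = -(f * g) := by ring

theorem fn_neg_mul (f g : A.Fn) : -f * g = -(f * g) := by ring

/-- The Hessian of `f` along the Hamiltonian vector fields of `l` and `m`. -/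
def hess (S : A.StarProduct P) (l m f : A.Fn) : A.Fn :=
  ∑ a, ∑ b, S.bil 1 l (A.coord a) * S.bil 1 m (A.coord b) * A.pd a (A.pd b f)

/-- The derivative of the Hamiltonian vector field of `m` along that of `l`, applied to `f`. -/
def hamDeriv (S : A.StarProduct P) (l m f : A.Fn) : A.Fn :=
  ∑ b, S.bil 1 l (S.bil 1 m (A.coord b)) * A.pd b f

theorem hess_add_left (l l' m f : A.Fn) : S.hess (l + l') m f = S.hess l m f + S.hess l' m f := by
  simp only [hess, map_add, LinearMap.add_apply, add_mul, Finset.sum_add_distrib]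

theorem hess_sub_left (l l' m f : A.Fn) : S.hess (l - l') m f = S.hess l m f - S.hess l' m f := by
  simp only [hess, map_sub, LinearMap.sub_apply, sub_mul, Finset.sum_sub_distrib]

theorem hess_add_right (l m m' f : A.Fn) : S.hess l (m + m') f = S.hess l m f + S.hess l m' f := by
  simp only [hess, map_add, LinearMap.add_apply, add_mul, mul_add, Finset.sum_add_distrib]

theorem hess_sub_right (l m m' f : A.Fn) : S.hess l (m - m') f = S.hess l m f - S.hess l m' f := by
  simp only [hess, map_sub, LinearMap.sub_apply, sub_mul, mul_sub, Finset.sum_sub_distrib]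

theorem hess_add (l m f g : A.Fn) : S.hess l m (f + g) = S.hess l m f + S.hess l m g := by
  simp only [hess, pd_add, mul_add, Finset.sum_add_distrib]

theorem hess_sub (l m f g : A.Fn) : S.hess l m (f - g) = S.hess l m f - S.hess l m g := by
  simp only [hess, pd_sub, mul_sub, Finset.sum_sub_distrib]

theorem hess_neg (l m f : A.Fn) : S.hess l m (-f) = -S.hess l m f := by
  simp only [hess, pd_neg, fn_mul_neg, Finset.sum_neg_distrib]

theorem hamDeriv_neg (l m f : A.Fn) : S.hamDeriv l m (-f) = -S.hamDeriv l m f := by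
  simp only [hamDeriv, pd_neg, fn_mul_neg, Finset.sum_neg_distrib]

theorem hess_comm (l m f : A.Fn) : S.hess l m f = S.hess m l f := by
  rw [hess, hess, Finset.sum_comm]
  refine Finset.sum_congr rfl fun a _ => Finset.sum_congr rfl fun b _ => ?_
  rw [pd_comm]; ring

theorem HasCoeffs.swap_two {Γ : ℕ → (n : ℕ) → Fin N → (Fin n → Fin N) → A.Fn}
    (hΓ : S.HasCoeffs Γ) (r : ℕ) (i j k : Fin N) :
    Γ r 2 i ![k, j] = Γ r 2 i ![j, k] := by
  rw [← hΓ.symm r 2 i ![k, j] (Equiv.swap 0 1)]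
  congr 1
  ext a; fin_cases a <;> rfl

theorem HasCoeffs.coeff_zero_two {Γ : ℕ → (n : ℕ) → Fin N → (Fin n → Fin N) → A.Fn}
    (hΓ : S.HasCoeffs Γ) (h1 : ∀ i j, Γ 1 1 i ![j] = 0) (i j k : Fin N) :
    Γ 0 2 i ![j, k] = (1 / 2 : ℂ) • S.bil 2 (A.coord i) (A.coord j * A.coord k) := by
  rw [hΓ.bil_two_coord]
  simp [h1, pd_mul, pd_add, pd_coord, apply_ite (A.pd _), pd_zero, mul_add,
    Finset.sum_add_distrib, hΓ.swap_two 0 i j k]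
  algebra

theorem _root_.FunctionAlgebra.IsAffine.sum_pd_mul_bil_one {m : A.Fn} (hm : IsAffine m) (f : A.Fn) :
    ∑ a, A.pd a m * S.bil 1 (A.coord a) f = S.bil 1 m f :=
  (hm.linearMap_apply ((S.bil 1).flip f) (S.bil_one_left one_ne_zero f)).symm

namespace IsAdmissible

variable (h : S.IsAdmissible) {l m k : A.Fn}
include h

/-- C_1(l, ·) is a vector field; the composition of two vector fields splits into a first-order
part, which differentiates the coefficients of the inner field, and a Hessian part. -/
theorem bil_one_bil_one (hl : IsAffine l) (hm : IsAffine m) (f : A.Fn) :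
    S.bil 1 l (S.bil 1 m f) = S.hamDeriv l m f + S.hess l m f := by
  rw [h.bil_one_eq_sum hm, map_sum]
  simp only [h.bil_one_mul hl, Finset.sum_add_distrib]
  rw [add_comm, hamDeriv]
  congr 1
  · exact Finset.sum_congr rfl fun b _ => mul_comm _ _
  · rw [hess, Finset.sum_comm]
    refine Finset.sum_congr rfl fun b _ => ?_
    rw [h.bil_one_eq_sum hl (A.pd b f), Finset.mul_sum]
    exact Finset.sum_congr rfl fun b _ => by ring

theorem bil_two_mul_affine (hl : IsAffine l) (hk : IsAffine k) (hm : IsAffine m) :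
    S.bil 2 m (l * k) = (1 / 3 : ℂ) • (S.bil 1 l (S.bil 1 k m) + S.bil 1 k (S.bil 1 l m)) := by
  have e1 := h.bil_two_sq (hl.add hk) hm
  have e2 := h.bil_two_sq (hl.sub hk) hm
  rw [show (l + k) ^ 2 = l ^ 2 + (2 : ℂ) • (l * k) + k ^ 2 by algebra] at e1
  rw [show (l - k) ^ 2 = l ^ 2 - (2 : ℂ) • (l * k) + k ^ 2 by algebra] at e2
  simp only [map_add, map_sub, map_smul, LinearMap.add_apply, LinearMap.sub_apply] at e1 e2
  linear_combination (norm := algebra) (1 / 4 : ℂ) • e1 - (1 / 4 : ℂ) • e2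

/-- C_2(x^i, ·) has no first-order part by strict triangularity, so its coefficients are read off
from products of two coordinates. Commuting derivatives undo the symmetrization. -/
theorem bil_two_coord (i : Fin N) (g : A.Fn) :
    S.bil 2 (A.coord i) g = (1 / 3 : ℂ) • ∑ a, ∑ b,
      S.bil 1 (A.coord a) (S.bil 1 (A.coord b) (A.coord i)) * A.pd a (A.pd b g) := by
  obtain ⟨-, Γ, hΓ, hs⟩ := h.strict
  have e : ∀ a b, Γ 0 2 i ![a, b] = (1 / 6 : ℂ) •
      (S.bil 1 (A.coord a) (S.bil 1 (A.coord b) (A.coord i)) +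
        S.bil 1 (A.coord b) (S.bil 1 (A.coord a) (A.coord i))) := fun a b => by
    rw [hΓ.coeff_zero_two (hs 1 le_rfl), h.bil_two_mul_affine (isAffine_coord a)
      (isAffine_coord b) (isAffine_coord i)]
    algebra
  rw [hΓ.bil_two_coord]
  simp only [hs 1 le_rfl, zero_mul, Finset.sum_const_zero, zero_add, e, smul_mul_assoc, add_mul,
    ← Finset.smul_sum, Finset.sum_add_distrib]
  rw [Finset.sum_comm (f := fun a b =>
    S.bil 1 (A.coord b) (S.bil 1 (A.coord a) (A.coord i)) * A.pd a (A.pd b g))]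
  simp only [pd_comm _ _ g]
  algebra

theorem bil_two_eq (hl : IsAffine l) (g : A.Fn) :
    S.bil 2 l g = (1 / 3 : ℂ) • ∑ a, ∑ b,
      S.bil 1 (A.coord a) (S.bil 1 (A.coord b) l) * A.pd a (A.pd b g) := by
  have e1 := hl.linearMap_apply ((S.bil 2).flip g) (S.bil_one_left two_ne_zero g)
  have e2 : ∀ a b, S.bil 1 (A.coord a) (S.bil 1 (A.coord b) l) = ∑ i, A.pd i l *
      S.bil 1 (A.coord a) (S.bil 1 (A.coord b) (A.coord i)) := fun a b =>
    hl.linearMap_apply (S.bil 1 (A.coord a) ∘ₗ S.bil 1 (A.coord b)) (by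
      simp [S.bil_one_right one_ne_zero])
  simp only [LinearMap.flip_apply, h.bil_two_coord] at e1
  rw [e1]
  simp only [e2, Finset.sum_mul, mul_smul_comm, ← Finset.smul_sum, Finset.mul_sum]
  congr 1
  rw [Finset.sum_comm]
  refine Finset.sum_congr rfl fun a _ => ?_
  rw [Finset.sum_comm]
  exact Finset.sum_congr rfl fun a _ => Finset.sum_congr rfl fun b _ => by ring

theorem star_bil_two (hl : IsAffine l) (f : A.Fn) : star (S.bil 2 l f) = S.bil 2 l (star f) := by
  simp only [h.bil_two_eq hl, star_smul, star_sum, star_mul', h.star_bil_one (isAffine_coord _),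
    hl.star_eq, pd_star]
  simp

theorem sum_bil_one_mul_pd_self (f : A.Fn) :
    ∑ a, S.bil 1 (A.coord a) f * A.pd a f = 0 := by
  have e : ∑ a, S.bil 1 (A.coord a) f * A.pd a f = -∑ a, S.bil 1 (A.coord a) f * A.pd a f := by
    simp only [h.bil_one_coord, Finset.sum_mul]
    conv_rhs => rw [Finset.sum_comm]
    rw [← Finset.sum_neg_distrib]
    refine Finset.sum_congr rfl fun a _ => ?_
    rw [← Finset.sum_neg_distrib]
    refine Finset.sum_congr rfl fun b _ => ?_
    rw [h.bivector.antisymm a b]; ring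
  linear_combination (norm := algebra) (1 / 2 : ℂ) • e

/-- C_2(l, ·) is purely of second order, so its commutator with multiplication by the affine
function m is a vector field; the two terms are the contractions of dm with the two slots of the
coefficient. -/
theorem bil_two_mul (hl : IsAffine l) (hm : IsAffine m) (f : A.Fn) :
    S.bil 2 l (m * f) = m * S.bil 2 l f +
      (1 / 3 : ℂ) • (∑ a, S.bil 1 (A.coord a) (S.bil 1 m l) * A.pd a f - S.hamDeriv m l f) := by
  have e1 : S.hamDeriv m l f = -∑ b, S.bil 1 m (S.bil 1 (A.coord b) l) * A.pd b f := by
    rw [hamDeriv, ← Finset.sum_neg_distrib]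
    refine Finset.sum_congr rfl fun b _ => ?_
    rw [h.bil_one_antisymm hl (isAffine_coord b), map_neg, fn_neg_mul]
  have e2 : ∀ b, S.bil 1 m (S.bil 1 (A.coord b) l) =
      ∑ a, A.pd a m * S.bil 1 (A.coord a) (S.bil 1 (A.coord b) l) := fun b =>
    (hm.sum_pd_mul_bil_one _).symm
  have e3 : ∀ a, S.bil 1 (A.coord a) (S.bil 1 m l) =
      ∑ b, A.pd b m * S.bil 1 (A.coord a) (S.bil 1 (A.coord b) l) := fun a => by
    rw [← hm.sum_pd_mul_bil_one, map_sum]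
    exact Finset.sum_congr rfl fun b _ => hm.mul_linearMap_apply b _ _
  rw [h.bil_two_eq hl, h.bil_two_eq hl, e1]
  simp only [e2, e3, Finset.sum_mul, pd_mul, pd_add, hm.pd_pd]
  rw [Finset.sum_comm (f := fun b a =>
    A.pd a m * S.bil 1 (A.coord a) (S.bil 1 (A.coord b) l) * A.pd b f)]
  rw [mul_smul_comm, ← smul_add, Finset.mul_sum]
  congr 1
  rw [sub_neg_eq_add]
  simp only [Finset.mul_sum, ← Finset.sum_add_distrib]
  refine Finset.sum_congr rfl fun a _ => Finset.sum_congr rfl fun b _ => ?_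
  ring

/-- For f = C_1(l, m) one correction term is P contracted twice with df, which vanishes by
antisymmetry. -/
theorem bil_two_mul_bracket (hl : IsAffine l) (hm : IsAffine m) :
    S.bil 2 l (m * S.bil 1 l m) = m * S.bil 2 l (S.bil 1 l m) -
      (1 / 3 : ℂ) • S.hamDeriv m l (S.bil 1 l m) := by
  rw [h.bil_two_mul hl hm, h.bil_one_antisymm hm hl]
  simp only [map_neg, fn_neg_mul, Finset.sum_neg_distrib, h.sum_bil_one_mul_pd_self]
  algebra

theorem bil_two_self_mul (hl : IsAffine l) (f : A.Fn) :
    S.bil 2 l (l * f) = l * S.bil 2 l f - (1 / 3 : ℂ) • S.hamDeriv l l f := by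
  rw [h.bil_two_mul hl hl, h.bil_one_self hl]
  simp only [map_zero, zero_mul, Finset.sum_const_zero]
  algebra

/-- With X = C_3(m, l^2) and D = C_2(l, C_1(l, m)) real, the recursion reads -X* = D - X/2. At odd
order Hermiticity carries a minus sign, so the factor differs from that at second order. -/
theorem bil_three_sq (hl : IsAffine l) (hm : IsAffine m) :
    S.bil 3 m (l ^ 2) = (-2 : ℂ) • S.bil 2 l (S.bil 1 l m) := by
  have e1 := h.weyl.bil_pow_succ hl 3 1 m
  rw [h.hermitian.bil_right hm three_ne_zero (by rw [star_pow, hl.star_eq])] at e1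
  simp only [Finset.Nat.antidiagonal_succ] at e1
  simp [bil_zero, h.bil_two_affine hl hm, h.bil_three_affine hl hm,
    h.bil_mul_self_eq three_ne_zero hl hm] at e1
  have e2 := congrArg star e1
  simp only [star_star, star_add, star_smul, h.star_bil_one hl, h.star_bil_two hl,
    hm.star_eq] at e2
  simp at e2
  linear_combination (norm := algebra) (-2 / 3 : ℂ) • e1 - (4 / 3 : ℂ) • e2

theorem bil_one_sq (hl : IsAffine l) (g : A.Fn) :
    S.bil 1 (l ^ 2) g = (2 : ℂ) • (l * S.bil 1 l g) := by
  rw [h.weyl.bil_pow_succ hl 1 1 g]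
  simp [Finset.Nat.antidiagonal_succ, bil_zero, h.bil_one_mul hl, h.bil_one_self hl]
  algebra

theorem bil_two_sq_affine (hl : IsAffine l) (hm : IsAffine m) :
    S.bil 2 (l ^ 2) m = (2 / 3 : ℂ) • S.bil 1 l (S.bil 1 l m) := by
  rw [h.hermitian.bil_right hm two_ne_zero (by rw [star_pow, hl.star_eq]), h.bil_two_sq hl hm]
  simp [h.star_bil_one hl, hm.star_eq]

/-- The same mechanism as for squares. The first-order parts `hamDeriv` coming from C_1(l, C_2(l^2,
m)) and C_2(l, C_1(l^2, m)) cancel, which leaves only the Hessian and a term proportional to l that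
vanishes at zeros of l. -/
theorem bil_three_cube (hl : IsAffine l) (hm : IsAffine m) :
    S.bil 3 m (l ^ 3) = -((6 : ℂ) • (l * S.bil 2 l (S.bil 1 l m))) -
      S.hess l l (S.bil 1 l m) := by
  have e1 := h.weyl.bil_pow_succ hl 3 2 m
  have f3 : S.bil 3 (l ^ 2) m = (2 : ℂ) • S.bil 2 l (S.bil 1 l m) := by
    rw [h.hermitian.bil_right hm three_ne_zero (by rw [star_pow, hl.star_eq]), h.bil_three_sq hl hm]
    simp [h.star_bil_one hl, h.star_bil_two hl, hm.star_eq]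
    algebra
  rw [h.hermitian.bil_right hm three_ne_zero (by rw [star_pow, hl.star_eq])] at e1
  simp only [Finset.Nat.antidiagonal_succ] at e1
  simp [bil_zero, h.bil_one_sq hl, h.bil_two_sq_affine hl hm, f3, h.bil_sq_mul_eq three_ne_zero hl hm] at e1
  have e2 := congrArg star e1
  simp only [star_star, star_add, star_smul, star_mul', h.star_bil_one hl, h.star_bil_two hl,
    hm.star_eq, hl.star_eq] at e2
  simp at e2
  simp only [h.bil_two_self_mul hl, h.bil_one_bil_one hl hl (S.bil 1 l m)] at e1 e2
  linear_combination (norm := algebra) (-3 / 8 : ℂ) • e1 - (9 / 8 : ℂ) • e2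

end IsAdmissible

end FunctionAlgebra.StarProduct

/-! ### Values on pairs of powers at a common zero of l and m. -/

namespace FunctionAlgebra.StarProduct

variable {N : ℕ} {A : FunctionAlgebra N} {P : Fin N → Fin N → A.Fn} {S : A.StarProduct P}

theorem hamDeriv_mul (l m f g : A.Fn) :
    S.hamDeriv l m (f * g) = f * S.hamDeriv l m g + g * S.hamDeriv l m f := by
  simp only [hamDeriv, Finset.mul_sum, ← Finset.sum_add_distrib, pd_mul]
  exact Finset.sum_congr rfl fun b _ => by ring

namespace IsAdmissible

variable (h : S.IsAdmissible) {l m k : A.Fn} {x : Fin N → ℝ}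
include h

omit h in
theorem hamDeriv_affine (l k : A.Fn) (hm : IsAffine m) :
    S.hamDeriv l k m = S.bil 1 l (S.bil 1 k m) := by
  have e := hm.linearMap_apply (S.bil 1 l ∘ₗ S.bil 1 k)
    (by simp [S.bil_one_right one_ne_zero])
  simp only [LinearMap.comp_apply] at e
  rw [e, hamDeriv]
  exact Finset.sum_congr rfl fun b _ => mul_comm _ _

theorem evalAt_bil_mem (r : ℕ) (l : A.Fn) {f : A.Fn}
    (hf : f ∈ RingHom.ker (evalAt (A := A) x) ^ (r + 1)) : evalAt x (S.bil r l f) = 0 :=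
  ((h.strict.1 r).jetForm_right x l).apply_eq_zero_of_mem hf

theorem bil_two_sq_left (hl : IsAffine l) (g : A.Fn) :
    S.bil 2 (l ^ 2) g = l * S.bil 2 l g + S.bil 1 l (S.bil 1 l g) + S.bil 2 l (l * g) := by
  rw [h.weyl.bil_pow_succ hl 2 1 g]
  simp [Finset.Nat.antidiagonal_succ, bil_zero]
  ring

theorem bil_three_sq_left (hl : IsAffine l) (g : A.Fn) :
    S.bil 3 (l ^ 2) g = l * S.bil 3 l g + S.bil 1 l (S.bil 2 l g) + S.bil 2 l (S.bil 1 l g)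
      + S.bil 3 l (l * g) := by
  rw [h.weyl.bil_pow_succ hl 3 1 g]
  simp [Finset.Nat.antidiagonal_succ, bil_zero]
  ring

theorem bil_three_cube_left (hl : IsAffine l) (g : A.Fn) :
    S.bil 3 (l ^ 3) g = l * S.bil 3 (l ^ 2) g + S.bil 1 l (S.bil 2 (l ^ 2) g)
      + S.bil 2 l (S.bil 1 (l ^ 2) g) + S.bil 3 l (l ^ 2 * g) := by
  rw [h.weyl.bil_pow_succ hl 3 2 g]
  simp [Finset.Nat.antidiagonal_succ, bil_zero]
  ring

omit h in
theorem sum_bil_one_mul_pd_affine (hm : IsAffine m) (f : A.Fn) :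
    ∑ a, S.bil 1 (A.coord a) f * A.pd a m = S.bil 1 m f := by
  rw [← hm.sum_pd_mul_bil_one (S := S)]
  exact Finset.sum_congr rfl fun b _ => mul_comm _ _

theorem bil_two_mul_mul (hl : IsAffine l) (hm : IsAffine m) (f : A.Fn) :
    S.bil 2 l (m * (m * f)) = m * S.bil 2 l (m * f) +
      (1 / 3 : ℂ) • (m * ∑ a, S.bil 1 (A.coord a) (S.bil 1 m l) * A.pd a f
        - m * S.hamDeriv m l f) - (2 / 3 : ℂ) • (f * S.bil 1 m (S.bil 1 l m)) := by
  rw [h.bil_two_mul hl hm (m * f), hamDeriv_mul, hamDeriv_affine _ _ hm]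
  have e : ∑ a, S.bil 1 (A.coord a) (S.bil 1 m l) * A.pd a (m * f) =
      m * (∑ a, S.bil 1 (A.coord a) (S.bil 1 m l) * A.pd a f) - f * S.bil 1 m (S.bil 1 l m) := by
    have e1 : f * S.bil 1 m (S.bil 1 l m) =
        -(f * ∑ a, S.bil 1 (A.coord a) (S.bil 1 m l) * A.pd a m) := by
      rw [sum_bil_one_mul_pd_affine hm, h.bil_one_antisymm hl hm, map_neg]
      ring
    rw [e1, sub_neg_eq_add, Finset.mul_sum, Finset.mul_sum, ← Finset.sum_add_distrib]
    refine Finset.sum_congr rfl fun a _ => ?_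
    rw [pd_mul]; ring
  rw [e]
  algebra

theorem bil_two_cube_right (hl : IsAffine l) (hm : IsAffine m) :
    S.bil 2 l (m ^ 3) = (-2 : ℂ) • (m * S.bil 1 m (S.bil 1 l m)) := by
  have e : S.bil 2 l (m ^ 2) = (-2 / 3 : ℂ) • S.bil 1 m (S.bil 1 l m) := by
    rw [h.bil_two_sq hm hl, h.bil_one_antisymm hm hl, map_neg]
    algebra
  have e2 := h.bil_two_mul_mul hl hm m
  rw [show m * (m * m) = m ^ 3 by ring, show m * m = m ^ 2 by ring, e,
    sum_bil_one_mul_pd_affine hm, hamDeriv_affine _ _ hm, h.bil_one_antisymm hm hl, map_neg] at e2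
  rw [e2]
  algebra

variable (hl0 : evalAt x l = 0) (hm0 : evalAt x m = 0)

include hl0 hm0 in
-- Polarization of the formula for C_3(l, ·) on cubes, in the directions m ± l; the difference
-- isolates l m^2.
theorem evalAt_bil_three_mul_sq (hl : IsAffine l) (hm : IsAffine m) :
    evalAt x (S.bil 3 l (l * m ^ 2)) = 2 / 3 * evalAt x (S.hess l m (S.bil 1 l m)) := by
  have e1 := congrArg (evalAt x) (h.bil_three_cube (hm.add hl) hl)
  have e2 := congrArg (evalAt x) (h.bil_three_cube (hm.sub hl) hl)
  rw [show (m + l) ^ 3 = m ^ 3 + (3 : ℂ) • (l ^ 2 * m) + (3 : ℂ) • (l * m ^ 2) + l ^ 3 by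
    algebra] at e1
  rw [show (m - l) ^ 3 = m ^ 3 + (3 : ℂ) • (l ^ 2 * m) - (3 : ℂ) • (l * m ^ 2) - l ^ 3 by
    algebra] at e2
  have e0 : S.bil 1 m l = -S.bil 1 l m := h.bil_one_antisymm hm hl
  simp only [map_add, map_sub, map_smul, LinearMap.add_apply, LinearMap.sub_apply,
    h.bil_one_self hl, e0, add_zero, sub_zero, hess_add_left, hess_add_right, hess_sub_left,
    hess_sub_right, h.weyl.bil_pow hl three_ne_zero, map_mul, map_neg, hl0, hm0, hess_neg,
    smul_eq_mul, hess_comm m l] at e1 e2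
  linear_combination (1 / 6 : ℂ) * e1 - (1 / 6 : ℂ) * e2

include hm0 in
theorem evalAt_bil_three_cube_right (hl : IsAffine l) (hm : IsAffine m) :
    evalAt x (S.bil 3 l (m ^ 3)) = evalAt x (S.hess m m (S.bil 1 l m)) := by
  rw [h.bil_three_cube hm hl, h.bil_one_antisymm hm hl]
  simp [hess_neg, hm0]

theorem bil_three_sq_right (hl : IsAffine l) (hm : IsAffine m) :
    S.bil 3 l (m ^ 2) = (2 : ℂ) • S.bil 2 m (S.bil 1 l m) := by
  rw [h.bil_three_sq hm hl, h.bil_one_antisymm hm hl, map_neg]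
  algebra

theorem bil_three_affine_right (hl : IsAffine l) {f : A.Fn} (hf : star f = f) :
    S.bil 3 f l = -star (S.bil 3 l f) := by
  rw [h.hermitian.bil_right hl three_ne_zero hf]
  algebra

theorem star_hess (hl : IsAffine l) (hm : IsAffine m) (f : A.Fn) :
    star (S.hess l m f) = S.hess l m (star f) := by
  simp only [hess, star_sum, star_mul', h.star_bil_one hl, h.star_bil_one hm, star_coord, pd_star]

theorem bil_three_sq_affine (hl : IsAffine l) (hm : IsAffine m) :
    S.bil 3 (l ^ 2) m = -S.bil 3 m (l ^ 2) := by
  rw [h.bil_three_affine_right hm (by rw [star_pow, hl.star_eq]), h.bil_three_sq hl hm]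
  simp [h.star_bil_one hl, h.star_bil_two hl, hm.star_eq]

theorem bil_three_cube_affine (hl : IsAffine l) (hm : IsAffine m) :
    S.bil 3 (l ^ 3) m = -S.bil 3 m (l ^ 3) := by
  rw [h.bil_three_affine_right hm (by rw [star_pow, hl.star_eq]), h.bil_three_cube hl hm]
  simp [h.star_bil_one hl, h.star_bil_two hl, hm.star_eq, hl.star_eq, h.star_hess hl hl]

include hl0 hm0 in
-- The Hessian in C_1(l, C_2(l, m^2)) cancels against C_3(l, l m^2), so only first-order parts
-- survive.
theorem evalAt_bil_three_sq_sq (hl : IsAffine l) (hm : IsAffine m) :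
    evalAt x (S.bil 3 (l ^ 2) (m ^ 2)) = -2 / 3 * (evalAt x (S.hamDeriv m l (S.bil 1 l m))
      + evalAt x (S.hamDeriv l m (S.bil 1 l m))) := by
  have e1 : S.bil 1 l (m ^ 2) = (2 : ℂ) • (m * S.bil 1 l m) := by
    rw [pow_two, h.bil_one_mul hl]; algebra
  rw [h.bil_three_sq_left hl, h.bil_two_sq hm hl, e1, map_smul, map_smul,
    h.bil_two_mul_bracket hl hm, h.bil_one_antisymm hm hl, map_neg, map_neg,
    h.bil_one_bil_one hl hm]
  simp only [map_add, map_mul, hl0, map_smul, map_neg, map_sub, hm0,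
    h.evalAt_bil_three_mul_sq hl0 hm0 hl hm, smul_eq_mul]
  ring

include hl0 hm0 in
theorem evalAt_bil_three_sq_cube (hl : IsAffine l) (hm : IsAffine m) :
    evalAt x (S.bil 3 (l ^ 2) (m ^ 3)) =
      -4 * (evalAt x (S.bil 1 l m) * evalAt x (S.bil 1 m (S.bil 1 l m))) := by
  have e1 : S.bil 1 l (m ^ 3) = (3 : ℂ) • (m * (m * S.bil 1 l m)) := by
    rw [show m ^ 3 = m * (m * m) by ring, h.bil_one_mul hl, h.bil_one_mul hl]; algebra
  -- Triangularity enters here: l m^3 vanishes to fourth order at x, while C_3 differentiates at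
  -- most three times.
  have e2 : evalAt x (S.bil 3 l (l * m ^ 3)) = 0 := h.evalAt_bil_mem 3 l (by
    rw [pow_succ']
    exact Ideal.mul_mem_mul hl0 (Ideal.pow_mem_pow hm0 3))
  rw [h.bil_three_sq_left hl, e1, h.bil_two_cube_right hl hm, map_smul, map_smul,
    h.bil_two_mul_mul hl hm, h.bil_one_mul hl]
  simp only [map_add, map_mul, hl0, map_smul, map_sub, hm0, e2, smul_eq_mul]
  ring

include hl0 hm0 in
theorem evalAt_bil_three_cube_sq (hl : IsAffine l) (hm : IsAffine m) :
    evalAt x (S.bil 3 (l ^ 3) (m ^ 2)) =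
      4 * (evalAt x (S.bil 1 l m) * evalAt x (S.bil 1 l (S.bil 1 l m))) := by
  have e1 : S.bil 1 l (m ^ 2) = (2 : ℂ) • (m * S.bil 1 l m) := by
    rw [pow_two, h.bil_one_mul hl]; algebra
  have e2 : evalAt x (S.bil 3 l (l ^ 2 * m ^ 2)) = 0 := h.evalAt_bil_mem 3 l (by
    rw [show 3 + 1 = 2 + 2 by norm_num, pow_add]
    exact Ideal.mul_mem_mul (Ideal.pow_mem_pow hl0 2) (Ideal.pow_mem_pow hm0 2))
  rw [h.bil_three_cube_left hl, h.bil_two_sq_left hl, h.bil_one_sq hl, e1]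
  simp only [h.bil_two_self_mul hl, map_add, map_sub, map_smul, h.bil_one_mul hl,
    h.bil_one_self hl, hamDeriv_mul, pow_two m, hamDeriv_affine _ _ hm, mul_smul_comm,
    map_mul, hl0, hm0, smul_eq_mul, map_zero]
  rw [← pow_two, e2]
  ring

include hl0 hm0 in
theorem evalAt_bil_three_cube_cube (hl : IsAffine l) (hm : IsAffine m) :
    evalAt x (S.bil 3 (l ^ 3) (m ^ 3)) = 6 * evalAt x (S.bil 1 l m) ^ 3 := by
  have e1 : S.bil 1 l (m ^ 3) = (3 : ℂ) • (m * (m * S.bil 1 l m)) := by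
    rw [show m ^ 3 = m * (m * m) by ring, h.bil_one_mul hl, h.bil_one_mul hl]; algebra
  have e2 : evalAt x (S.bil 3 l (l ^ 2 * m ^ 3)) = 0 := h.evalAt_bil_mem 3 l (by
    refine Ideal.pow_le_pow_right (show 3 + 1 ≤ 2 + 3 by norm_num) ?_
    rw [pow_add]
    exact Ideal.mul_mem_mul (Ideal.pow_mem_pow hl0 2) (Ideal.pow_mem_pow hm0 3))
  rw [h.bil_three_cube_left hl, h.bil_two_sq_left hl, h.bil_one_sq hl, e1]
  simp only [h.bil_two_self_mul hl, map_add, map_sub, map_smul, h.bil_one_mul hl,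
    h.bil_one_self hl, hamDeriv_mul, show m ^ 3 = m * (m * m) by ring, hamDeriv_affine _ _ hm,
    mul_smul_comm, map_mul, hl0, hm0, smul_eq_mul, map_zero]
  rw [show m * (m * m) = m ^ 3 by ring, e2]
  ring

theorem bil_two_sq_right (hl : IsAffine l) (hm : IsAffine m) :
    S.bil 2 l (m ^ 2) = (-2 / 3 : ℂ) • S.bil 1 m (S.bil 1 l m) := by
  rw [h.bil_two_sq hm hl, h.bil_one_antisymm hm hl, map_neg]
  algebra

include hl0 hm0 in
theorem evalAt_bil_two_sq_sq (hl : IsAffine l) (hm : IsAffine m) :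
    evalAt x (S.bil 2 (l ^ 2) (m ^ 2)) = 2 * evalAt x (S.bil 1 l m) ^ 2 := by
  rw [h.bil_two_sq_left hl]
  simp only [h.bil_two_self_mul hl, map_add, map_sub, map_smul, h.bil_one_mul hl, hamDeriv_mul,
    pow_two m, hamDeriv_affine _ _ hm, map_mul, hl0, hm0, smul_eq_mul]
  ring

end IsAdmissible

end FunctionAlgebra.StarProduct

/-! ### The index sums of the formula, evaluated on affine functions. -/

namespace FunctionAlgebra

variable {N : ℕ} {A : FunctionAlgebra N}

section Terms

variable (P : Fin N → Fin N → A.Fn)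

/-- The third-order term with one derivative of `f` and two of `g`. -/
def termOneTwo (f g : A.Fn) : A.Fn :=
  ∑ i, ∑ j, ∑ k, ∑ l, ∑ m, ∑ n, P n l * A.pd l (P m k) * A.pd n (A.pd m (P i j)) *
    (A.pd i f * A.pd j (A.pd k g))

/-- The third-order term with two derivatives of each factor. -/
def termTwoTwo (f g : A.Fn) : A.Fn :=
  ∑ i, ∑ j, ∑ k, ∑ l, ∑ m, ∑ n, P n k * A.pd n (P j m) * A.pd m (P i l) *
    (A.pd i (A.pd j f) * A.pd k (A.pd l g))

/-- The third-order term with two derivatives of `f` and three of `g`. -/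
def termTwoThree (f g : A.Fn) : A.Fn :=
  ∑ i, ∑ j, ∑ k, ∑ l, ∑ m, ∑ n, P l n * A.pd l (P j m) * P i k *
    (A.pd i (A.pd j f) * A.pd k (A.pd n (A.pd m g)))

/-- The third-order term with three derivatives of each factor. -/
def termThreeThree (f g : A.Fn) : A.Fn :=
  ∑ i, ∑ j, ∑ k, ∑ l, ∑ m, ∑ n, P j l * P i m * P k n *
    (A.pd i (A.pd j (A.pd k f)) * A.pd l (A.pd n (A.pd m g)))

/-- The third-order term with one derivative of `f` and three of `g`. -/
def termOneThree (f g : A.Fn) : A.Fn :=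
  ∑ i, ∑ j, ∑ k, ∑ l, ∑ m, ∑ n, P n k * P m l * A.pd n (A.pd m (P i j)) *
    (A.pd i f * A.pd j (A.pd k (A.pd l g)))

/-- The second-order term with two derivatives of each factor. -/
def quadTwoTwo (f g : A.Fn) : A.Fn :=
  ∑ i, ∑ j, ∑ k, ∑ l, P i j * P k l * (A.pd i (A.pd k f) * A.pd j (A.pd l g))

/-- The second-order term with two derivatives of `f` and one of `g`. -/
def quadTwoOne (f g : A.Fn) : A.Fn :=
  ∑ i, ∑ j, ∑ k, ∑ l, P i j * A.pd j (P k l) * (A.pd i (A.pd k f) * A.pd l g)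

/-- The second-order term with one derivative of `f` and two of `g`. -/
def quadOneTwo (f g : A.Fn) : A.Fn :=
  ∑ i, ∑ j, ∑ k, ∑ l, P i j * A.pd j (P k l) * (A.pd k f * A.pd i (A.pd l g))

end Terms

variable {P : Fin N → Fin N → A.Fn} {S : A.StarProduct P}

/-- This and its four companions are the adjacent transpositions of six nested sums; chains of them
bring an expanded composition into the index order of the corresponding term. -/
theorem sum_swap_first {α M : Type*} [Fintype α] [AddCommMonoid M]
    (F : α → α → α → α → α → α → M) :
    ∑ a, ∑ b, ∑ c, ∑ d, ∑ e, ∑ f, F a b c d e f = ∑ b, ∑ a, ∑ c, ∑ d, ∑ e, ∑ f, F a b c d e f :=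
  Finset.sum_comm

theorem sum_swap_second {α M : Type*} [Fintype α] [AddCommMonoid M]
    (F : α → α → α → α → α → α → M) :
    ∑ a, ∑ b, ∑ c, ∑ d, ∑ e, ∑ f, F a b c d e f = ∑ a, ∑ c, ∑ b, ∑ d, ∑ e, ∑ f, F a b c d e f :=
  Finset.sum_congr rfl fun _ _ => Finset.sum_comm

theorem sum_swap_third {α M : Type*} [Fintype α] [AddCommMonoid M]
    (F : α → α → α → α → α → α → M) :
    ∑ a, ∑ b, ∑ c, ∑ d, ∑ e, ∑ f, F a b c d e f = ∑ a, ∑ b, ∑ d, ∑ c, ∑ e, ∑ f, F a b c d e f :=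
  Finset.sum_congr rfl fun _ _ => Finset.sum_congr rfl fun _ _ => Finset.sum_comm

theorem sum_swap_fourth {α M : Type*} [Fintype α] [AddCommMonoid M]
    (F : α → α → α → α → α → α → M) :
    ∑ a, ∑ b, ∑ c, ∑ d, ∑ e, ∑ f, F a b c d e f = ∑ a, ∑ b, ∑ c, ∑ e, ∑ d, ∑ f, F a b c d e f :=
  Finset.sum_congr rfl fun _ _ => Finset.sum_congr rfl fun _ _ => Finset.sum_congr rfl fun _ _ =>
    Finset.sum_comm

theorem sum_swap_fifth {α M : Type*} [Fintype α] [AddCommMonoid M]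
    (F : α → α → α → α → α → α → M) :
    ∑ a, ∑ b, ∑ c, ∑ d, ∑ e, ∑ f, F a b c d e f = ∑ a, ∑ b, ∑ c, ∑ d, ∑ f, ∑ e, F a b c d e f :=
  Finset.sum_congr rfl fun _ _ => Finset.sum_congr rfl fun _ _ => Finset.sum_congr rfl fun _ _ =>
    Finset.sum_congr rfl fun _ _ => Finset.sum_comm

theorem sum_congr_six {α M : Type*} [Fintype α] [AddCommMonoid M]
    {F G : α → α → α → α → α → α → M} (h : ∀ a b c d e f, F a b c d e f = G a b c d e f) :
    ∑ a, ∑ b, ∑ c, ∑ d, ∑ e, ∑ f, F a b c d e f = ∑ a, ∑ b, ∑ c, ∑ d, ∑ e, ∑ f, G a b c d e f := by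
  simp only [h]

namespace StarProduct.IsAdmissible

variable (h : S.IsAdmissible) {l m : A.Fn}
include h

theorem three_smul_bil_two (hl : IsAffine l) (hm : IsAffine m) :
    (3 : ℂ) • S.bil 2 m (S.bil 1 l m) =
      ∑ i, ∑ j, ∑ k, ∑ l', ∑ m', ∑ n, P n l' * A.pd l' (P m' k) * A.pd n (A.pd m' (P i j)) *
        (A.pd i l * (A.pd j m * A.pd k m)) := by
  rw [h.bil_two_eq hm, smul_smul, show (3 : ℂ) * (1 / 3) = 1 by norm_num, one_smul]
  simp only [h.bil_one_coord, h.bil_one hl, pd_sum, pd_mul, hl.pd_pd, hm.pd_pd, mul_zero,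
    add_zero, zero_add, Finset.sum_mul, Finset.mul_sum]
  rw [sum_swap_first, sum_swap_second, sum_swap_third, sum_swap_fourth, sum_swap_fifth,
    sum_swap_first, sum_swap_second, sum_swap_third, sum_swap_fourth, sum_swap_third]
  exact sum_congr_six fun i j k l' m' n => by ring

/-- The sign comes from one factor P whose indices appear in opposite order on the two sides. -/
theorem neg_hamDeriv (hl : IsAffine l) (hm : IsAffine m) :
    -S.hamDeriv m l (S.bil 1 l m) =
      ∑ i, ∑ j, ∑ k, ∑ l', ∑ m', ∑ n, P n k * A.pd n (P j m') * A.pd m' (P i l') *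
        (A.pd i l * A.pd j l * (A.pd k m * A.pd l' m)) := by
  simp only [StarProduct.hamDeriv, h.bil_one hl, h.bil_one hm, pd_sum, pd_mul, hl.pd_pd, hm.pd_pd, mul_zero,
    add_zero, zero_add, Finset.sum_mul, Finset.mul_sum, pd_coord, mul_ite, mul_one, Finset.sum_ite_eq', Finset.mem_univ, if_true]
  rw [sum_swap_first, sum_swap_second, sum_swap_third, sum_swap_fifth, sum_swap_second,
    sum_swap_fourth, sum_swap_third, sum_swap_second]
  simp only [← Finset.sum_neg_distrib]
  refine sum_congr_six fun i j k l' m' n => ?_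
  rw [h.bivector.antisymm n k]; ring

theorem neg_bil_one_bil_one_mul (hl : IsAffine l) (hm : IsAffine m) :
    -(S.bil 1 m (S.bil 1 l m) * S.bil 1 l m) =
      ∑ i, ∑ j, ∑ k, ∑ l', ∑ m', ∑ n, P l' n * A.pd l' (P j m') * P i k *
        (A.pd i l * A.pd j l * (A.pd k m * A.pd n m * A.pd m' m)) := by
  simp only [h.bil_one hl, h.bil_one hm, pd_sum, pd_mul, hl.pd_pd, hm.pd_pd, mul_zero,
    add_zero, zero_add, Finset.sum_mul, Finset.mul_sum]
  rw [sum_swap_third, sum_swap_fourth, sum_swap_fifth, sum_swap_third, sum_swap_second]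
  simp only [← Finset.sum_neg_distrib]
  refine sum_congr_six fun i j k l' m' n => ?_
  rw [h.bivector.antisymm l' n]; ring

theorem bil_one_cube (hl : IsAffine l) :
    S.bil 1 l m ^ 3 =
      ∑ i, ∑ j, ∑ k, ∑ l', ∑ m', ∑ n, P j l' * P i m' * P k n *
        (A.pd i l * A.pd j l * A.pd k l * (A.pd l' m * A.pd n m * A.pd m' m)) := by
  rw [pow_succ, pow_two]
  simp only [h.bil_one hl, Finset.sum_mul, Finset.mul_sum]
  rw [sum_swap_second, sum_swap_third, sum_swap_fourth, sum_swap_fifth, sum_swap_first,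
    sum_swap_third, sum_swap_fourth, sum_swap_second]
  exact sum_congr_six fun i j k l' m' n => by ring

theorem hess_bil_one (hl : IsAffine l) (hm : IsAffine m) :
    S.hess m m (S.bil 1 l m) =
      ∑ i, ∑ j, ∑ k, ∑ l', ∑ m', ∑ n, P n k * P m' l' * A.pd n (A.pd m' (P i j)) *
        (A.pd i l * (A.pd j m * A.pd k m * A.pd l' m)) := by
  simp only [StarProduct.hess, h.bil_one hl, h.bil_one hm, pd_sum, pd_mul, hl.pd_pd, hm.pd_pd, mul_zero,
    add_zero, zero_add, Finset.sum_mul, Finset.mul_sum, pd_coord, mul_ite, mul_one, Finset.sum_ite_eq', Finset.mem_univ, if_true]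
  rw [sum_swap_first, sum_swap_second, sum_swap_third, sum_swap_fourth, sum_swap_fifth,
    sum_swap_first, sum_swap_second, sum_swap_third, sum_swap_fourth, sum_swap_third]
  refine sum_congr_six fun i j k l' m' n => ?_
  rw [h.bivector.antisymm n k, h.bivector.antisymm m' l']; ring

theorem quad_two_two (hl : IsAffine l) :
    S.bil 1 l m ^ 2 =
      ∑ i, ∑ j, ∑ k, ∑ l', P i j * P k l' * (A.pd i l * A.pd k l * (A.pd j m * A.pd l' m)) := by
  rw [pow_two]
  simp only [h.bil_one hl, Finset.sum_mul, Finset.mul_sum]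
  exact Finset.sum_congr rfl fun i _ => Finset.sum_congr rfl fun j _ =>
    Finset.sum_congr rfl fun k _ => Finset.sum_congr rfl fun l' _ => by ring

theorem quad_two_one (hl : IsAffine l) (hm : IsAffine m) :
    S.bil 1 l (S.bil 1 l m) =
      ∑ i, ∑ j, ∑ k, ∑ l', P i j * A.pd j (P k l') * (A.pd i l * A.pd k l * A.pd l' m) := by
  simp only [h.bil_one hl, pd_sum, pd_mul, hl.pd_pd, hm.pd_pd, mul_zero,
    add_zero, zero_add, Finset.mul_sum]
  exact Finset.sum_congr rfl fun i _ => Finset.sum_congr rfl fun j _ =>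
    Finset.sum_congr rfl fun k _ => Finset.sum_congr rfl fun l' _ => by ring

theorem quad_one_two (hl : IsAffine l) (hm : IsAffine m) :
    S.bil 1 m (S.bil 1 l m) =
      ∑ i, ∑ j, ∑ k, ∑ l', P i j * A.pd j (P k l') * (A.pd k l * (A.pd i m * A.pd l' m)) := by
  simp only [h.bil_one hl, h.bil_one hm, pd_sum, pd_mul, hl.pd_pd, hm.pd_pd, mul_zero,
    add_zero, zero_add, Finset.mul_sum]
  exact Finset.sum_congr rfl fun i _ => Finset.sum_congr rfl fun j _ =>
    Finset.sum_congr rfl fun k _ => Finset.sum_congr rfl fun l' _ => by ring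

end StarProduct.IsAdmissible

end FunctionAlgebra

/-! ### Comparison on powers and the formulas for C_1, C_2 and C_3. -/

namespace FunctionAlgebra

variable {N : ℕ} {A : FunctionAlgebra N}

/-- Bidifferential expressions of order at most three agree if they agree on powers of affine
functions. -/
theorem eq_of_forall_evalAt_pow {r : ℕ} (hr : r ≤ 3) {B R : A.Fn → A.Fn → A.Fn}
    (hBl : ∀ x g, JetForm x r fun f => evalAt x (B f g))
    (hBr : ∀ x f, JetForm x r fun g => evalAt x (B f g))
    (hRl : ∀ x g, JetForm x r fun f => evalAt x (R f g))
    (hRr : ∀ x f, JetForm x r fun g => evalAt x (R f g))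
    (h0 : ∀ (x : Fin N → ℝ) (l m : A.Fn), IsAffine l → IsAffine m → evalAt x l = 0 →
      evalAt x m = 0 → ∀ a ≤ r, ∀ b ≤ r,
        evalAt x (B (l ^ a) (m ^ b)) = evalAt x (R (l ^ a) (m ^ b)))
    (f g : A.Fn) : B f g = R f g := by
  refine ext_evalAt fun x => sub_eq_zero.1 ?_
  refine ((hBl x g).sub (hRl x g)).eq_zero hr (fun l hl hl0 a ha => ?_) f
  refine ((hBr x (l ^ a)).sub (hRr x (l ^ a))).eq_zero hr (fun m hm hm0 b hb => ?_) g
  exact sub_eq_zero.2 (h0 x l m hl hm hl0 hm0 a ha b hb)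

section Jets

variable (P : Fin N → Fin N → A.Fn) (x : Fin N → ℝ)

theorem jetForm_termOneTwo_left {r : ℕ} (hr : 3 ≤ r) (g : A.Fn) :
    JetForm x r fun f => evalAt x (termOneTwo P f g) := by
  simp only [termOneTwo, map_sum, map_mul]
  exact .sum _ fun i => .sum _ fun j => .sum _ fun k => .sum _ fun l => .sum _ fun m =>
    .sum _ fun n => ((JetForm.deriv_one (by omega) _).mul_const _).const_mul _

theorem jetForm_termOneTwo_right {r : ℕ} (hr : 3 ≤ r) (f : A.Fn) :
    JetForm x r fun g => evalAt x (termOneTwo P f g) := by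
  simp only [termOneTwo, map_sum, map_mul]
  exact .sum _ fun i => .sum _ fun j => .sum _ fun k => .sum _ fun l => .sum _ fun m =>
    .sum _ fun n => ((JetForm.deriv_two (by omega) _ _).const_mul _).const_mul _

theorem jetForm_termTwoTwo_left {r : ℕ} (hr : 3 ≤ r) (g : A.Fn) :
    JetForm x r fun f => evalAt x (termTwoTwo P f g) := by
  simp only [termTwoTwo, map_sum, map_mul]
  exact .sum _ fun i => .sum _ fun j => .sum _ fun k => .sum _ fun l => .sum _ fun m =>
    .sum _ fun n => ((JetForm.deriv_two (by omega) _ _).mul_const _).const_mul _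

theorem jetForm_termTwoTwo_right {r : ℕ} (hr : 3 ≤ r) (f : A.Fn) :
    JetForm x r fun g => evalAt x (termTwoTwo P f g) := by
  simp only [termTwoTwo, map_sum, map_mul]
  exact .sum _ fun i => .sum _ fun j => .sum _ fun k => .sum _ fun l => .sum _ fun m =>
    .sum _ fun n => ((JetForm.deriv_two (by omega) _ _).const_mul _).const_mul _

theorem jetForm_termTwoThree_left {r : ℕ} (hr : 3 ≤ r) (g : A.Fn) :
    JetForm x r fun f => evalAt x (termTwoThree P f g) := by
  simp only [termTwoThree, map_sum, map_mul]
  exact .sum _ fun i => .sum _ fun j => .sum _ fun k => .sum _ fun l => .sum _ fun m =>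
    .sum _ fun n => ((JetForm.deriv_two (by omega) _ _).mul_const _).const_mul _

theorem jetForm_termTwoThree_right {r : ℕ} (hr : 3 ≤ r) (f : A.Fn) :
    JetForm x r fun g => evalAt x (termTwoThree P f g) := by
  simp only [termTwoThree, map_sum, map_mul]
  exact .sum _ fun i => .sum _ fun j => .sum _ fun k => .sum _ fun l => .sum _ fun m =>
    .sum _ fun n => ((JetForm.deriv_three hr _ _ _).const_mul _).const_mul _

theorem jetForm_termThreeThree_left {r : ℕ} (hr : 3 ≤ r) (g : A.Fn) :
    JetForm x r fun f => evalAt x (termThreeThree P f g) := by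
  simp only [termThreeThree, map_sum, map_mul]
  exact .sum _ fun i => .sum _ fun j => .sum _ fun k => .sum _ fun l => .sum _ fun m =>
    .sum _ fun n => ((JetForm.deriv_three hr _ _ _).mul_const _).const_mul _

theorem jetForm_termThreeThree_right {r : ℕ} (hr : 3 ≤ r) (f : A.Fn) :
    JetForm x r fun g => evalAt x (termThreeThree P f g) := by
  simp only [termThreeThree, map_sum, map_mul]
  exact .sum _ fun i => .sum _ fun j => .sum _ fun k => .sum _ fun l => .sum _ fun m =>
    .sum _ fun n => ((JetForm.deriv_three hr _ _ _).const_mul _).const_mul _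

theorem jetForm_termOneThree_left {r : ℕ} (hr : 3 ≤ r) (g : A.Fn) :
    JetForm x r fun f => evalAt x (termOneThree P f g) := by
  simp only [termOneThree, map_sum, map_mul]
  exact .sum _ fun i => .sum _ fun j => .sum _ fun k => .sum _ fun l => .sum _ fun m =>
    .sum _ fun n => ((JetForm.deriv_one (by omega) _).mul_const _).const_mul _

theorem jetForm_termOneThree_right {r : ℕ} (hr : 3 ≤ r) (f : A.Fn) :
    JetForm x r fun g => evalAt x (termOneThree P f g) := by
  simp only [termOneThree, map_sum, map_mul]
  exact .sum _ fun i => .sum _ fun j => .sum _ fun k => .sum _ fun l => .sum _ fun m =>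
    .sum _ fun n => ((JetForm.deriv_three hr _ _ _).const_mul _).const_mul _

theorem jetForm_quadTwoTwo_left {r : ℕ} (hr : 2 ≤ r) (g : A.Fn) :
    JetForm x r fun f => evalAt x (quadTwoTwo P f g) := by
  simp only [quadTwoTwo, map_sum, map_mul]
  exact .sum _ fun i => .sum _ fun j => .sum _ fun k => .sum _ fun l =>
    ((JetForm.deriv_two hr _ _).mul_const _).const_mul _

theorem jetForm_quadTwoTwo_right {r : ℕ} (hr : 2 ≤ r) (f : A.Fn) :
    JetForm x r fun g => evalAt x (quadTwoTwo P f g) := by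
  simp only [quadTwoTwo, map_sum, map_mul]
  exact .sum _ fun i => .sum _ fun j => .sum _ fun k => .sum _ fun l =>
    ((JetForm.deriv_two hr _ _).const_mul _).const_mul _

theorem jetForm_quadTwoOne_left {r : ℕ} (hr : 2 ≤ r) (g : A.Fn) :
    JetForm x r fun f => evalAt x (quadTwoOne P f g) := by
  simp only [quadTwoOne, map_sum, map_mul]
  exact .sum _ fun i => .sum _ fun j => .sum _ fun k => .sum _ fun l =>
    ((JetForm.deriv_two hr _ _).mul_const _).const_mul _

theorem jetForm_quadTwoOne_right {r : ℕ} (hr : 2 ≤ r) (f : A.Fn) :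
    JetForm x r fun g => evalAt x (quadTwoOne P f g) := by
  simp only [quadTwoOne, map_sum, map_mul]
  exact .sum _ fun i => .sum _ fun j => .sum _ fun k => .sum _ fun l =>
    ((JetForm.deriv_one (by omega) _).const_mul _).const_mul _

theorem jetForm_quadOneTwo_left {r : ℕ} (hr : 2 ≤ r) (g : A.Fn) :
    JetForm x r fun f => evalAt x (quadOneTwo P f g) := by
  simp only [quadOneTwo, map_sum, map_mul]
  exact .sum _ fun i => .sum _ fun j => .sum _ fun k => .sum _ fun l =>
    ((JetForm.deriv_one (by omega) _).mul_const _).const_mul _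

theorem jetForm_quadOneTwo_right {r : ℕ} (hr : 2 ≤ r) (f : A.Fn) :
    JetForm x r fun g => evalAt x (quadOneTwo P f g) := by
  simp only [quadOneTwo, map_sum, map_mul]
  exact .sum _ fun i => .sum _ fun j => .sum _ fun k => .sum _ fun l =>
    ((JetForm.deriv_two hr _ _).const_mul _).const_mul _

end Jets

section Powers

variable {x : Fin N → ℝ} {l m : A.Fn} {a b : ℕ}

/-- At a zero of an affine l, p derivatives of l^a with a ≤ 3 survive only for a = p and give p!
times the product of first derivatives. Hence each index sum is detected by exactly one pair of
exponents. -/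
theorem evalAt_pd_pow (hl0 : evalAt x l = 0) (ha : a ≤ 3) (i : Fin N) :
    evalAt x (A.pd i (l ^ a)) = (if a = 1 then 1 else 0) * evalAt x (A.pd i l) := by
  interval_cases a <;> simp [pow_succ, pd_mul, pd_one, hl0]

theorem evalAt_pd_pd_pow (hl : IsAffine l) (hl0 : evalAt x l = 0) (ha : a ≤ 3) (i j : Fin N) :
    evalAt x (A.pd i (A.pd j (l ^ a))) =
      (if a = 2 then 2 else 0) * (evalAt x (A.pd i l) * evalAt x (A.pd j l)) := by
  interval_cases a <;>
    simp [pow_succ, pd_mul, pd_add, pd_one, pd_zero, hl0, hl.pd_pd]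
  ring

theorem evalAt_pd_pd_pd_pow (hl : IsAffine l) (ha : a ≤ 3)
    (i j k : Fin N) :
    evalAt x (A.pd i (A.pd j (A.pd k (l ^ a)))) =
      (if a = 3 then 6 else 0) *
        (evalAt x (A.pd i l) * evalAt x (A.pd j l) * evalAt x (A.pd k l)) := by
  interval_cases a <;>
    simp [pow_succ, pd_mul, pd_add, pd_one, pd_zero, hl.pd_pd]
  ring

variable {P : Fin N → Fin N → A.Fn} {S : A.StarProduct P} (h : S.IsAdmissible)
  (hl : IsAffine l) (hm : IsAffine m) (hl0 : evalAt x l = 0) (hm0 : evalAt x m = 0)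
  (ha : a ≤ 3) (hb : b ≤ 3)
include h hl hm hl0 hm0 ha hb

theorem evalAt_termOneTwo : evalAt x (termOneTwo P (l ^ a) (m ^ b)) =
    (if a = 1 then 1 else 0) * (if b = 2 then 2 else 0) *
      (3 * evalAt x (S.bil 2 m (S.bil 1 l m))) := by
  have e := congrArg (evalAt x) (h.three_smul_bil_two hl hm)
  rw [map_smul, smul_eq_mul] at e
  rw [e]
  simp only [termOneTwo, map_sum, map_mul, evalAt_pd_pow hl0 ha, evalAt_pd_pd_pow hm hm0 hb,
    Finset.mul_sum]
  exact sum_congr_six fun i j k l' m' n => by ring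

theorem evalAt_termTwoTwo : evalAt x (termTwoTwo P (l ^ a) (m ^ b)) =
    (if a = 2 then 2 else 0) * (if b = 2 then 2 else 0) *
      -evalAt x (S.hamDeriv m l (S.bil 1 l m)) := by
  have e := congrArg (evalAt x) (h.neg_hamDeriv hl hm)
  rw [map_neg] at e
  rw [e]
  simp only [termTwoTwo, map_sum, map_mul, evalAt_pd_pd_pow hl hl0 ha, evalAt_pd_pd_pow hm hm0 hb,
    Finset.mul_sum]
  exact sum_congr_six fun i j k l' m' n => by ring

omit hm0 in
theorem evalAt_termTwoThree : evalAt x (termTwoThree P (l ^ a) (m ^ b)) =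
    (if a = 2 then 2 else 0) * (if b = 3 then 6 else 0) *
      -(evalAt x (S.bil 1 m (S.bil 1 l m)) * evalAt x (S.bil 1 l m)) := by
  have e := congrArg (evalAt x) (h.neg_bil_one_bil_one_mul hl hm)
  rw [map_neg, map_mul] at e
  rw [e]
  simp only [termTwoThree, map_sum, map_mul, evalAt_pd_pd_pow hl hl0 ha,
    evalAt_pd_pd_pd_pow hm hb, Finset.mul_sum]
  exact sum_congr_six fun i j k l' m' n => by ring

omit hl0 hm0 in
theorem evalAt_termThreeThree : evalAt x (termThreeThree P (l ^ a) (m ^ b)) =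
    (if a = 3 then 6 else 0) * (if b = 3 then 6 else 0) * evalAt x (S.bil 1 l m) ^ 3 := by
  have e := congrArg (evalAt x) (h.bil_one_cube (m := m) hl)
  rw [map_pow] at e
  rw [e]
  simp only [termThreeThree, map_sum, map_mul, evalAt_pd_pd_pd_pow hl ha,
    evalAt_pd_pd_pd_pow hm hb, Finset.mul_sum]
  exact sum_congr_six fun i j k l' m' n => by ring

omit hm0 in
theorem evalAt_termOneThree : evalAt x (termOneThree P (l ^ a) (m ^ b)) =
    (if a = 1 then 1 else 0) * (if b = 3 then 6 else 0) *
      evalAt x (S.hess m m (S.bil 1 l m)) := by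
  have e := congrArg (evalAt x) (h.hess_bil_one hl hm)
  rw [e]
  simp only [termOneThree, map_sum, map_mul, evalAt_pd_pow hl0 ha,
    evalAt_pd_pd_pd_pow hm hb, Finset.mul_sum]
  exact sum_congr_six fun i j k l' m' n => by ring

theorem evalAt_quadTwoTwo : evalAt x (quadTwoTwo P (l ^ a) (m ^ b)) =
    (if a = 2 then 2 else 0) * (if b = 2 then 2 else 0) * evalAt x (S.bil 1 l m) ^ 2 := by
  have e := congrArg (evalAt x) (h.quad_two_two (m := m) hl)
  rw [map_pow] at e
  rw [e]
  simp only [quadTwoTwo, map_sum, map_mul, evalAt_pd_pd_pow hl hl0 ha,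
    evalAt_pd_pd_pow hm hm0 hb, Finset.mul_sum]
  exact Finset.sum_congr rfl fun i _ => Finset.sum_congr rfl fun j _ =>
    Finset.sum_congr rfl fun k _ => Finset.sum_congr rfl fun l' _ => by ring

theorem evalAt_quadTwoOne : evalAt x (quadTwoOne P (l ^ a) (m ^ b)) =
    (if a = 2 then 2 else 0) * (if b = 1 then 1 else 0) *
      evalAt x (S.bil 1 l (S.bil 1 l m)) := by
  have e := congrArg (evalAt x) (h.quad_two_one hl hm)
  rw [e]
  simp only [quadTwoOne, map_sum, map_mul, evalAt_pd_pd_pow hl hl0 ha,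
    evalAt_pd_pow hm0 hb, Finset.mul_sum]
  exact Finset.sum_congr rfl fun i _ => Finset.sum_congr rfl fun j _ =>
    Finset.sum_congr rfl fun k _ => Finset.sum_congr rfl fun l' _ => by ring

theorem evalAt_quadOneTwo : evalAt x (quadOneTwo P (l ^ a) (m ^ b)) =
    (if a = 1 then 1 else 0) * (if b = 2 then 2 else 0) *
      evalAt x (S.bil 1 m (S.bil 1 l m)) := by
  have e := congrArg (evalAt x) (h.quad_one_two hl hm)
  rw [e]
  simp only [quadOneTwo, map_sum, map_mul, evalAt_pd_pd_pow hm hm0 hb,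
    evalAt_pd_pow hl0 ha, Finset.mul_sum]
  exact Finset.sum_congr rfl fun i _ => Finset.sum_congr rfl fun j _ =>
    Finset.sum_congr rfl fun k _ => Finset.sum_congr rfl fun l' _ => by ring

end Powers

namespace StarProduct.IsAdmissible

variable {P : Fin N → Fin N → A.Fn} {S : A.StarProduct P} (h : S.IsAdmissible)
include h

theorem jetForm_bil_left (r : ℕ) (x : Fin N → ℝ) (g : A.Fn) :
    JetForm x r fun f => evalAt x (S.bil r f g) := (h.strict.1 r).jetForm_left x g

theorem jetForm_bil_right (r : ℕ) (x : Fin N → ℝ) (f : A.Fn) :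
    JetForm x r fun g => evalAt x (S.bil r f g) := (h.strict.1 r).jetForm_right x f

theorem bil_one_formula (f g : A.Fn) :
    S.bil 1 f g = ∑ i, ∑ j, A.pd i f * P i j * A.pd j g := by
  refine eq_of_forall_evalAt_pow (r := 1) (by norm_num)
    (R := fun f g => ∑ i, ∑ j, A.pd i f * P i j * A.pd j g)
    (h.jetForm_bil_left 1) (h.jetForm_bil_right 1) ?_ ?_ ?_ f g
  · intro x g
    simp only [map_sum, map_mul]
    exact .sum _ fun i => .sum _ fun j => ((JetForm.deriv_one le_rfl _).mul_const _).mul_const _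
  · intro x f
    simp only [map_sum, map_mul]
    exact .sum _ fun i => .sum _ fun j => (JetForm.deriv_one le_rfl _).const_mul _
  · intro x l m hl hm hl0 hm0 a ha b hb
    interval_cases a
    · simp [S.bil_one_left one_ne_zero, pd_one]
    · rw [pow_one, h.bil_one hl]

theorem bil_two_formula (f g : A.Fn) :
    S.bil 2 f g = (1 / 2 : ℂ) • quadTwoTwo P f g +
      (1 / 3 : ℂ) • (quadTwoOne P f g - quadOneTwo P f g) := by
  refine eq_of_forall_evalAt_pow (r := 2) (by norm_num)
    (R := fun f g => (1 / 2 : ℂ) • quadTwoTwo P f g +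
      (1 / 3 : ℂ) • (quadTwoOne P f g - quadOneTwo P f g))
    (h.jetForm_bil_left 2) (h.jetForm_bil_right 2) ?_ ?_ ?_ f g
  · intro x g
    simp only [map_add, map_smul, map_sub, smul_eq_mul]
    exact ((jetForm_quadTwoTwo_left P x le_rfl g).const_mul _).add
      (((jetForm_quadTwoOne_left P x le_rfl g).sub
        (jetForm_quadOneTwo_left P x le_rfl g)).const_mul _)
  · intro x f
    simp only [map_add, map_smul, map_sub, smul_eq_mul]
    exact ((jetForm_quadTwoTwo_right P x le_rfl f).const_mul _).add
      (((jetForm_quadTwoOne_right P x le_rfl f).sub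
        (jetForm_quadOneTwo_right P x le_rfl f)).const_mul _)
  · intro x l m hl hm hl0 hm0 a ha b hb
    have ha' : a ≤ 3 := by omega
    have hb' : b ≤ 3 := by omega
    simp only [map_add, map_smul, map_sub, smul_eq_mul,
      evalAt_quadTwoTwo h hl hm hl0 hm0 ha' hb', evalAt_quadTwoOne h hl hm hl0 hm0 ha' hb',
      evalAt_quadOneTwo h hl hm hl0 hm0 ha' hb']
    interval_cases a <;> interval_cases b <;>
      simp [S.bil_one_left two_ne_zero, S.bil_one_right two_ne_zero, h.bil_two_affine hl hm,
        h.bil_two_sq_right hl hm, h.bil_two_sq_affine hl hm, h.evalAt_bil_two_sq_sq hl0 hm0 hl hm]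
    all_goals ring

theorem bil_three_formula (f g : A.Fn) :
    S.bil 3 f g = (1 / 3 : ℂ) • (termOneTwo P f g - termOneTwo P g f) +
      (1 / 6 : ℂ) • (termTwoTwo P f g - termTwoTwo P g f) +
      (1 / 3 : ℂ) • (termTwoThree P f g - termTwoThree P g f) +
      (1 / 6 : ℂ) • termThreeThree P f g +
      (1 / 6 : ℂ) • (termOneThree P f g - termOneThree P g f) := by
  refine eq_of_forall_evalAt_pow (r := 3) le_rfl
    (R := fun f g => (1 / 3 : ℂ) • (termOneTwo P f g - termOneTwo P g f) +
      (1 / 6 : ℂ) • (termTwoTwo P f g - termTwoTwo P g f) +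
      (1 / 3 : ℂ) • (termTwoThree P f g - termTwoThree P g f) +
      (1 / 6 : ℂ) • termThreeThree P f g +
      (1 / 6 : ℂ) • (termOneThree P f g - termOneThree P g f))
    (h.jetForm_bil_left 3) (h.jetForm_bil_right 3) ?_ ?_ ?_ f g
  · intro x g
    simp only [map_add, map_smul, map_sub, smul_eq_mul]
    exact (((((((jetForm_termOneTwo_left P x le_rfl g).sub
      (jetForm_termOneTwo_right P x le_rfl g)).const_mul _).add
      (((jetForm_termTwoTwo_left P x le_rfl g).sub
      (jetForm_termTwoTwo_right P x le_rfl g)).const_mul _))).add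
      (((jetForm_termTwoThree_left P x le_rfl g).sub
      (jetForm_termTwoThree_right P x le_rfl g)).const_mul _)).add
      ((jetForm_termThreeThree_left P x le_rfl g).const_mul _)).add
      (((jetForm_termOneThree_left P x le_rfl g).sub
      (jetForm_termOneThree_right P x le_rfl g)).const_mul _)
  · intro x f
    simp only [map_add, map_smul, map_sub, smul_eq_mul]
    exact (((((((jetForm_termOneTwo_right P x le_rfl f).sub
      (jetForm_termOneTwo_left P x le_rfl f)).const_mul _).add
      (((jetForm_termTwoTwo_right P x le_rfl f).sub
      (jetForm_termTwoTwo_left P x le_rfl f)).const_mul _))).add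
      (((jetForm_termTwoThree_right P x le_rfl f).sub
      (jetForm_termTwoThree_left P x le_rfl f)).const_mul _)).add
      ((jetForm_termThreeThree_right P x le_rfl f).const_mul _)).add
      (((jetForm_termOneThree_right P x le_rfl f).sub
      (jetForm_termOneThree_left P x le_rfl f)).const_mul _)
  · intro x l m hl hm hl0 hm0 a ha b hb
    have e : S.bil 1 m l = -S.bil 1 l m := h.bil_one_antisymm hm hl
    simp only [map_add, map_smul, map_sub, smul_eq_mul,
      evalAt_termOneTwo h hl hm hl0 hm0 ha hb, evalAt_termOneTwo h hm hl hm0 hl0 hb ha,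
      evalAt_termTwoTwo h hl hm hl0 hm0 ha hb, evalAt_termTwoTwo h hm hl hm0 hl0 hb ha,
      evalAt_termTwoThree h hl hm hl0 ha hb, evalAt_termTwoThree h hm hl hm0 hb ha,
      evalAt_termThreeThree h hl hm ha hb,
      evalAt_termOneThree h hl hm hl0 ha hb, evalAt_termOneThree h hm hl hm0 hb ha,
      e, map_neg, hess_neg, hamDeriv_neg]
    -- Exponent 0 falls to the unit condition; the other nine pairs of exponents are the values
    -- computed above, with the coefficients 1/3 and 1/6 compensated by the factorials.
    interval_cases a <;> interval_cases b <;>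
      simp [S.bil_one_left three_ne_zero, S.bil_one_right three_ne_zero, h.bil_three_affine hl hm,
        h.bil_three_sq_right hl hm, h.evalAt_bil_three_cube_right hm0 hl hm,
        h.bil_three_sq_affine hl hm, h.bil_three_cube_affine hl hm,
        h.bil_three_sq_right hm hl, h.evalAt_bil_three_cube_right hl0 hm hl, e, hess_neg,
        h.evalAt_bil_three_sq_sq hl0 hm0 hl hm, h.evalAt_bil_three_sq_cube hl0 hm0 hl hm,
        h.evalAt_bil_three_cube_sq hl0 hm0 hl hm, h.evalAt_bil_three_cube_cube hl0 hm0 hl hm]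
    all_goals ring

end StarProduct.IsAdmissible

end FunctionAlgebra

/-! ### The coefficients Γ. -/

namespace FunctionAlgebra.StarProduct

variable {N : ℕ} {A : FunctionAlgebra N} {P : Fin N → Fin N → A.Fn} {S : A.StarProduct P}
  {Γ : ℕ → (n : ℕ) → Fin N → (Fin n → Fin N) → A.Fn}

theorem HasCoeffs.swap_three_left (hΓ : S.HasCoeffs Γ) (r : ℕ) (i j k l : Fin N) :
    Γ r 3 i ![k, j, l] = Γ r 3 i ![j, k, l] := by
  rw [← hΓ.symm r 3 i ![k, j, l] (Equiv.swap 0 1)]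
  congr 1
  ext a; fin_cases a <;> rfl

theorem HasCoeffs.swap_three_right (hΓ : S.HasCoeffs Γ) (r : ℕ) (i j k l : Fin N) :
    Γ r 3 i ![j, l, k] = Γ r 3 i ![j, k, l] := by
  rw [← hΓ.symm r 3 i ![j, l, k] (Equiv.swap 1 2)]
  congr 1
  ext a; fin_cases a <;> rfl

theorem HasCoeffs.coeff_one_two (hΓ : S.HasCoeffs Γ) (h1 : ∀ i j, Γ 2 1 i ![j] = 0)
    (i j k : Fin N) :
    Γ 1 2 i ![j, k] = (1 / 2 : ℂ) • S.bil 3 (A.coord i) (A.coord j * A.coord k) := by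
  rw [hΓ.bil_three_coord]
  simp [h1, pd_mul, pd_add, pd_coord, apply_ite (A.pd _), pd_one, pd_zero, mul_add,
    Finset.sum_add_distrib, hΓ.swap_two 1 i j k]
  algebra

/-- Centring the coordinates at x kills the lower-order terms of C_3(x^i, ·); the factor 1/6
accounts for the 3! equal contributions of the symmetric coefficient. -/
theorem HasCoeffs.evalAt_coeff_zero_three (hΓ : S.HasCoeffs Γ) (h1 : ∀ i j, Γ 2 1 i ![j] = 0)
    (x : Fin N → ℝ) (i j k l : Fin N) :
    evalAt x (Γ 0 3 i ![j, k, l]) = 1 / 6 * evalAt x (S.bil 3 (A.coord i)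
      (A.centred x j * A.centred x k * A.centred x l)) := by
  rw [hΓ.bil_three_coord]
  simp [h1, pd_mul, pd_add, pd_smul, pd_centred, evalAt_centred, mul_add,
    Finset.sum_add_distrib, -ite_smul]
  rw [hΓ.swap_three_left 0 i k l j, hΓ.swap_three_right 0 i k j l, hΓ.swap_three_left 0 i j l k,
    hΓ.swap_three_right 0 i j k l, hΓ.swap_three_left 0 i j k l]
  ring

namespace IsAdmissible

variable (h : S.IsAdmissible) {l m k : A.Fn} {x : Fin N → ℝ}
include h

theorem bil_three_mul_affine (hl : IsAffine l) (hk : IsAffine k) (hm : IsAffine m) :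
    S.bil 3 m (l * k) = -(S.bil 2 l (S.bil 1 k m) + S.bil 2 k (S.bil 1 l m)) := by
  have e1 := h.bil_three_sq (hl.add hk) hm
  have e2 := h.bil_three_sq (hl.sub hk) hm
  rw [show (l + k) ^ 2 = l ^ 2 + (2 : ℂ) • (l * k) + k ^ 2 by algebra] at e1
  rw [show (l - k) ^ 2 = l ^ 2 - (2 : ℂ) • (l * k) + k ^ 2 by algebra] at e2
  simp only [map_add, map_sub, map_smul, LinearMap.add_apply, LinearMap.sub_apply] at e1 e2
  linear_combination (norm := algebra) (1 / 4 : ℂ) • e1 - (1 / 4 : ℂ) • e2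

theorem evalAt_bil_three_mul_mul {n : A.Fn} (hl : IsAffine l) (hk : IsAffine k) (hn : IsAffine n)
    (hm : IsAffine m) (hl0 : evalAt x l = 0) (hk0 : evalAt x k = 0) (hn0 : evalAt x n = 0) :
    evalAt x (S.bil 3 m (l * k * n)) = 1 / 3 * (evalAt x (S.hess l k (S.bil 1 m n)) +
      evalAt x (S.hess l n (S.bil 1 m k)) + evalAt x (S.hess k n (S.bil 1 m l))) := by
  have e1 := h.evalAt_bil_three_cube_right (m := l + k + n) (x := x) (by simp [hl0, hk0, hn0]) hm
    ((hl.add hk).add hn)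
  have e2 := h.evalAt_bil_three_cube_right (m := l + k - n) (x := x) (by simp [hl0, hk0, hn0]) hm
    ((hl.add hk).sub hn)
  have e3 := h.evalAt_bil_three_cube_right (m := l - k + n) (x := x) (by simp [hl0, hk0, hn0]) hm
    ((hl.sub hk).add hn)
  have e4 := h.evalAt_bil_three_cube_right (m := l - k - n) (x := x) (by simp [hl0, hk0, hn0]) hm
    ((hl.sub hk).sub hn)
  have e : l * k * n = (1 / 24 : ℂ) •
      ((l + k + n) ^ 3 - (l + k - n) ^ 3 - (l - k + n) ^ 3 + (l - k - n) ^ 3) := by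
    algebra
  rw [e, map_smul, map_add, map_sub, map_sub, map_smul, map_add, map_sub, map_sub, e1, e2, e3, e4]
  simp only [map_add, map_sub, hess_add_left, hess_add_right, hess_sub_left, hess_sub_right,
    hess_add, hess_sub, hess_comm k l, hess_comm n l, hess_comm n k, smul_eq_mul]
  ring

theorem coeff_one (hΓ : S.HasCoeffs Γ) (i j : Fin N) : Γ 0 1 i ![j] = P i j := by
  rw [← h.bil_one_coord_coord, hΓ.bil_one_coord]
  simp [pd_coord]

/-- Strict triangularity only provides some family with this vanishing. It passes to an arbitrary
family because the coefficient equals C_2(x^i, x^j), which does not depend on the family. -/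
theorem coeff_one_one (hΓ : S.HasCoeffs Γ) (i j : Fin N) : Γ 1 1 i ![j] = 0 := by
  rw [← h.bil_two_affine (isAffine_coord i) (isAffine_coord j), hΓ.bil_two_coord]
  simp [pd_coord, apply_ite (A.pd _), pd_one, pd_zero]

theorem coeff_two_one (hΓ : S.HasCoeffs Γ) (i j : Fin N) : Γ 2 1 i ![j] = 0 := by
  rw [← h.bil_three_affine (isAffine_coord i) (isAffine_coord j), hΓ.bil_three_coord]
  simp [pd_coord, apply_ite (A.pd _), pd_one, pd_zero]

theorem coeff_zero_two_eq (hΓ : S.HasCoeffs Γ) (i j k : Fin N) :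
    Γ 0 2 i ![j, k] =
      (1 / 6 : ℂ) • ∑ l, (P k l * A.pd l (P j i) + P j l * A.pd l (P k i)) := by
  rw [hΓ.coeff_zero_two (h.coeff_one_one hΓ), h.bil_two_mul_affine (isAffine_coord j)
    (isAffine_coord k) (isAffine_coord i), h.bil_one_coord_coord, h.bil_one_coord_coord,
    h.bil_one_coord, h.bil_one_coord, Finset.sum_add_distrib]
  algebra

theorem coeff_one_two_eq (hΓ : S.HasCoeffs Γ) (i j k : Fin N) :
    Γ 1 2 i ![j, k] =
      (1 / 6 : ℂ) • ∑ l, ∑ m, ∑ n,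
        (P l m * A.pd l (P k n) * A.pd m (A.pd n (P i j)) +
          P l m * A.pd l (P j n) * A.pd m (A.pd n (P i k))) := by
  have e : ∀ j k, S.bil 2 (A.coord j) (P k i) = (-1 / 3 : ℂ) • ∑ l, ∑ m, ∑ n,
      P l m * A.pd l (P j n) * A.pd m (A.pd n (P i k)) := fun j k => by
    have e1 : ∑ a, ∑ b, S.bil 1 (A.coord a) (S.bil 1 (A.coord b) (A.coord j)) *
        A.pd a (A.pd b (P k i)) = -∑ l, ∑ m, ∑ n,
      P l m * A.pd l (P j n) * A.pd m (A.pd n (P i k)) := by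
      conv_rhs => rw [Finset.sum_comm]
      rw [← Finset.sum_neg_distrib]
      refine Finset.sum_congr rfl fun a _ => ?_
      rw [Finset.sum_comm, ← Finset.sum_neg_distrib]
      refine Finset.sum_congr rfl fun b _ => ?_
      rw [h.bil_one_coord_coord, h.bil_one_coord, Finset.sum_mul, ← Finset.sum_neg_distrib]
      refine Finset.sum_congr rfl fun l _ => ?_
      -- Three transpositions of indices account for the overall minus sign.
      rw [h.bivector.antisymm a l, h.bivector.antisymm b j, h.bivector.antisymm k i]
      simp only [pd_neg]
      ring
    rw [h.bil_two_coord, e1]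
    algebra
  rw [hΓ.coeff_one_two (h.coeff_two_one hΓ), h.bil_three_mul_affine (isAffine_coord j)
    (isAffine_coord k) (isAffine_coord i), h.bil_one_coord_coord, h.bil_one_coord_coord, e, e]
  simp only [Finset.sum_add_distrib]
  algebra

theorem coeff_zero_three_eq (hΓ : S.HasCoeffs Γ) (i j k l : Fin N) :
    Γ 0 3 i ![j, k, l] =
      (1 / 18 : ℂ) • ∑ m, ∑ n,
        (P j m * P k n * A.pd m (A.pd n (P i l)) +
          P l m * P k n * A.pd m (A.pd n (P i j)) +
          P j m * P l n * A.pd m (A.pd n (P i k))) := by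
  have hV : ∀ x j g, S.bil 1 (A.centred x j) g = S.bil 1 (A.coord j) g := fun x j g => by
    rw [centred, map_sub, LinearMap.sub_apply, map_smul, LinearMap.smul_apply,
      S.bil_one_left one_ne_zero, smul_zero, sub_zero]
  have hV' : ∀ x i j, S.bil 1 (A.coord i) (A.centred x j) = P i j := fun x i j => by
    rw [centred, map_sub, map_smul, S.bil_one_right one_ne_zero, smul_zero, sub_zero,
      h.bil_one_coord_coord]
  refine ext_evalAt fun x => ?_
  rw [hΓ.evalAt_coeff_zero_three (h.coeff_two_one hΓ), h.evalAt_bil_three_mul_mul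
    (isAffine_centred x j) (isAffine_centred x k) (isAffine_centred x l) (isAffine_coord i)
    (evalAt_centred x j) (evalAt_centred x k) (evalAt_centred x l)]
  -- Only the pair (k, l) is swapped, to match the order of the factors P^{lm} P^{kn} in the stated
  -- formula.
  rw [hess_comm (A.centred x k)]
  simp only [hess, hV, hV', h.bil_one_coord_coord, Finset.sum_add_distrib, map_add, map_smul,
    smul_eq_mul]
  ring

end IsAdmissible

end FunctionAlgebra.StarProduct

end

theorem mainTheorem3 {N : ℕ} (A : FunctionAlgebra N) (P : Fin N → Fin N → A.Fn)
    (hP : A.IsBivector P) (S : A.StarProduct P) (hW : S.IsWeyl) (hH : S.IsWeaklyHermitian)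
    (hT : S.IsStrictlyTriangular) :
    (∀ Γ, S.HasCoeffs Γ →
      (∀ i j, Γ 0 1 i ![j] = P i j) ∧
      (∀ i j k, Γ 0 2 i ![j, k] =
        (1 / 6 : ℂ) • ∑ l, (P k l * A.pd l (P j i) + P j l * A.pd l (P k i))) ∧
      (∀ i j k l, Γ 0 3 i ![j, k, l] =
        (1 / 18 : ℂ) • ∑ m, ∑ n,
          (P j m * P k n * A.pd m (A.pd n (P i l)) +
            P l m * P k n * A.pd m (A.pd n (P i j)) +
            P j m * P l n * A.pd m (A.pd n (P i k)))) ∧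
      (∀ i j k, Γ 1 2 i ![j, k] =
        (1 / 6 : ℂ) • ∑ l, ∑ m, ∑ n,
          (P l m * A.pd l (P k n) * A.pd m (A.pd n (P i j)) +
            P l m * A.pd l (P j n) * A.pd m (A.pd n (P i k))))) ∧
    (∀ f g : A.Fn,
      PowerSeries.coeff 0 (S.mul (PowerSeries.C f) (PowerSeries.C g)) = f * g ∧
      PowerSeries.coeff 1 (S.mul (PowerSeries.C f) (PowerSeries.C g)) =
        Complex.I • ∑ i, ∑ j, A.pd i f * P i j * A.pd j g ∧
      PowerSeries.coeff 2 (S.mul (PowerSeries.C f) (PowerSeries.C g)) =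
        -((1 / 2 : ℂ) • ∑ i, ∑ j, ∑ k, ∑ l,
            P i j * P k l * A.pd i (A.pd k f) * A.pd j (A.pd l g)) -
          (1 / 3 : ℂ) • ∑ i, ∑ j, ∑ k, ∑ l,
            P i j * A.pd j (P k l) *
              (A.pd i (A.pd k f) * A.pd l g - A.pd k f * A.pd i (A.pd l g)) ∧
      PowerSeries.coeff 3 (S.mul (PowerSeries.C f) (PowerSeries.C g)) =
        -(Complex.I • ∑ i, ∑ j, ∑ k, ∑ l, ∑ m, ∑ n,
          ((1 / 3 : ℂ) • (P n l * A.pd l (P m k) * A.pd n (A.pd m (P i j)) *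
              (A.pd i f * A.pd j (A.pd k g) - A.pd i g * A.pd j (A.pd k f))) +
            (1 / 6 : ℂ) • (P n k * A.pd n (P j m) * A.pd m (P i l) *
              (A.pd i (A.pd j f) * A.pd k (A.pd l g) -
                A.pd i (A.pd j g) * A.pd k (A.pd l f))) +
            (1 / 3 : ℂ) • (P l n * A.pd l (P j m) * P i k *
              (A.pd i (A.pd j f) * A.pd k (A.pd n (A.pd m g)) -
                A.pd i (A.pd j g) * A.pd k (A.pd n (A.pd m f)))) +
            (1 / 6 : ℂ) • (P j l * P i m * P k n *
              A.pd i (A.pd j (A.pd k f)) * A.pd l (A.pd n (A.pd m g))) +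
            (1 / 6 : ℂ) • (P n k * P m l * A.pd n (A.pd m (P i j)) *
              (A.pd i f * A.pd j (A.pd k (A.pd l g)) -
                A.pd i g * A.pd j (A.pd k (A.pd l f))))))) := by
  have h : S.IsAdmissible := ⟨hP, hW, hH, hT⟩
  refine ⟨fun Γ hΓ => ⟨h.coeff_one hΓ, h.coeff_zero_two_eq hΓ, h.coeff_zero_three_eq hΓ,
    h.coeff_one_two_eq hΓ⟩, fun f g => ⟨?_, ?_, ?_, ?_⟩⟩
  · rw [FunctionAlgebra.StarProduct.coeff_mul_C_C, S.bil_zero]; simp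
  · rw [FunctionAlgebra.StarProduct.coeff_mul_C_C, h.bil_one_formula, pow_one]
  · rw [FunctionAlgebra.StarProduct.coeff_mul_C_C, h.bil_two_formula, Complex.I_sq]
    have e1 : ∑ i, ∑ j, ∑ k, ∑ l, P i j * P k l * A.pd i (A.pd k f) * A.pd j (A.pd l g) =
        FunctionAlgebra.quadTwoTwo P f g := by
      simp only [FunctionAlgebra.quadTwoTwo, mul_assoc]
    have e2 : ∑ i, ∑ j, ∑ k, ∑ l, P i j * A.pd j (P k l) *
          (A.pd i (A.pd k f) * A.pd l g - A.pd k f * A.pd i (A.pd l g)) =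
        FunctionAlgebra.quadTwoOne P f g - FunctionAlgebra.quadOneTwo P f g := by
      simp only [FunctionAlgebra.quadTwoOne, FunctionAlgebra.quadOneTwo, mul_sub,
        Finset.sum_sub_distrib]
    rw [e1, e2]
    algebra
  · rw [FunctionAlgebra.StarProduct.coeff_mul_C_C, h.bil_three_formula, Complex.I_pow_three,
      neg_smul]
    congr 2
    simp only [FunctionAlgebra.termOneTwo, FunctionAlgebra.termTwoTwo,
      FunctionAlgebra.termTwoThree, FunctionAlgebra.termThreeThree, FunctionAlgebra.termOneThree,
      ← Finset.sum_sub_distrib, Finset.smul_sum, ← Finset.sum_add_distrib]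
    refine FunctionAlgebra.sum_congr_six fun i j k l m n => ?_
    simp only [mul_sub, mul_assoc]
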